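/- Let $(\Omega,\mathcal A,\mathbb P)$ be a probability space, $(E,\mathcal T)$ a measurable space, $X=(X_i)_{i\ge1}$ a stationary $E$-valued process, $T$ the shift on $E^{\mathbb N_+}$ and $d\ge 1$. For each $n\ge1$ let $S_n\Phi:E^{\mathbb N_+}\to\mathbb R^d$ be measurable, let $\mu_n$ be the law of $S_n\Phi(X)/n$, and put $\Lambda_n(\lambda)=\frac1n\log\int e^{n\langle\lambda,x\rangle}\,d\mu_n(x)$ for $\lambda\in\mathbb R^d$. Let $(k(n))_{n\ge1}$ be a nondecreasing sequence of positive integers, and for $\omega\in\Omega$ put $$\mu_n^\omega=\frac1{k(n)}\sum_{j=1}^{k(n)}\delta_{S_n\Phi(T^{(j-1)n}X(\omega))/n},\qquad \Lambda_n^\omega(\lambda)=\frac1n\log\int e^{n\langle\lambda,x\rangle}\,d\mu_n^\omega(x).$$ Let $\alpha_{X,0}=\frac12$ and, for $m\ge1$, $\alpha_{X,m}=\sup_{i\ge1}\sup\{|\mathbb P(U)\mathbb P(V)-\mathbb P(U\cap V)|: U\in\sigma(X_k:k\le i),\ V\in\sigma(X_j:j\ge i+m)\}$, and let $\alpha_X^{-1}(u)=\inf\{m\ge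 0:\alpha_{X,m}\le u\}$ for $u\in[0,1]$, with $\inf\emptyset=\infty$. Assume: * (A1'') for each $\lambda\in\mathbb R^d$ the limit $\Lambda(\lambda)=\lim_{n\to\infty}\Lambda_n(\lambda)$ exists as an extended real number, and the origin belongs to the interior of $\mathcal D_\Lambda=\{\lambda:\Lambda(\lambda)<\infty\}$; * (A2) $\int_0^1(\alpha_X^{-1}(u))^h\,du<\infty$ for all $h>0$; * (A3) there are functions $S_n\Phi_n:E^{\mathbb N_+}\to\mathbb R^d$, each depending only on the first $2n$ coordinates, with $\sup_{z\in E^{\mathbb N_+}}\|S_n\Phi(z)-S_n\Phi_n(z)\|/n\to0$ as $n\to\infty$. Let $\Lambda^*(x)=\sup_{\lambda\in\mathbb R^d}(\langle\lambda,x\rangle-\Lambda(\lambda))$ and $\mathcal D_{\Lambda^*}=\{x:\Lambda^*(x)<\infty\}$. Let $\mathcal F$ be the set of exposed points of $\Lambda^*$ with an exposing hyperplane in the interior of $\mathcal D_\Lambda$, that is, of those $y\in\mathbb R^d$ for which there is $\lambda$ in the interior of $\mathcal D_\Lambda$ with $\langle\lambda,y\rangle-\Lambda^*(y)>\langle\lambda,x\rangle-\Lambda^*(x)$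 for all $x\ne y$. Suppose that either $$\sup_{x\in\mathcal D_{\Lambda^*}}\Lambda^*(x)<\infty\quad\text{and}\quad\liminf_{n\to\infty}\frac{\log k(n)}n>\sup_{x\in\mathcal D_{\Lambda^*}}\Lambda^*(x),$$ or $\lim_{n\to\infty}\frac{\log k(n)}n=\infty$. Then $\Lambda$ does not take the value $-\infty$ and, with probability $1$: 1. $\Lambda_n^\omega$ converges to $\Lambda$ uniformly on every compact subset of the interior of $\mathcal D_\Lambda$; 2. for every closed $F\subset\mathbb R^d$, $\ \limsup_{n\to\infty}\frac1n\log\mu_n^\omega(F)\le-\inf_{x\in F}\Lambda^*(x)$; 3. for every open $G\subset\mathbb R^d$, $\ \liminf_{n\to\infty}\frac1n\log\mu_n^\omega(G)\ge-\inf_{x\in G\cap\mathcal F}\Lambda^*(x)$; 4. if moreover $\Lambda$ is lower semicontinuous and essentially smooth (that is: $\mathcal D_\Lambda$ has non-empty interior, $\Lambda$ is differentiable there, and $\|\nabla\Lambda(\lambda_m)\|\to\infty$ whenever $(\lambda_m)$ is a sequence in this interior that converges to a boundary point of it), then $\Lambda^*$ is a good rate function (it is lower semicontinuous with values in $[0,\infty]$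 and its level sets $\{\Lambda^*\le a\}$, $a\ge0$, are compact) and $(\mu_n^\omega)_{n\ge1}$ satisfies the large deviation principle with rate function $\Lambda^*$: for every set $\Gamma$ in the completed Borel $\sigma$-algebra of $\mathbb R^d$ (in particular for every Borel set), with interior $\Gamma^\circ$ and closure $\overline\Gamma$, $$-\inf_{x\in\Gamma^\circ}\Lambda^*(x)\le\liminf_{n\to\infty}\tfrac1n\log\mu_n^\omega(\Gamma)\le\limsup_{n\to\infty}\tfrac1n\log\mu_n^\omega(\Gamma)\le-\inf_{x\in\overline\Gamma}\Lambda^*(x).$$ -/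

import Mathlib

open MeasureTheory ProbabilityTheory Filter Topology
open scoped ENNReal

noncomputable section

namespace LocalFluctuations

/-! ### Strong mixing.
Sequences indexed by the positive integers are modelled on `ℕ`: the coordinate `X i` here is
the usual `X_{i+1}`. -/

/-- The strong mixing coefficient of two sub-sigma-algebras,
`sup { |P(U) P(V) - P(U ∩ V)| : U ∈ 𝒰, V ∈ 𝒱 }` (a supremum of real numbers in `[0,1]`). -/
def alphaCoeff {Ω : Type*} [MeasurableSpace Ω] (P : Measure Ω) (𝒰 𝒱 : MeasurableSpace Ω) : ℝ :=
  sSup {r : ℝ | ∃ U V : Set Ω, MeasurableSet[𝒰] U ∧ MeasurableSet[𝒱] V ∧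
    r = |P.real U * P.real V - P.real (U ∩ V)|}

/-- Rosenblatt's mixing coefficients of the sequence `X`: `1/2` for `m = 0`, and the supremum over
`i` of the coefficient between `σ(X_k : k ≤ i)` and `σ(X_j : j ≥ i + m)` for `m ≥ 1`. -/
def mixingCoeff {Ω E : Type*} [MeasurableSpace Ω] [mE : MeasurableSpace E] (P : Measure Ω)
    (X : ℕ → Ω → E) (m : ℕ) : ℝ :=
  if m = 0 then 1 / 2
  else ⨆ i : ℕ, alphaCoeff P (⨆ k ∈ Set.Iic i, mE.comap (X k))
    (⨆ j ∈ Set.Ici (i + m), mE.comap (X j))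

/-- The inverse `u ↦ inf { m : α_{X,m} ≤ u }`, equal to `∞` if there is no such `m`. -/
def mixingInv {Ω E : Type*} [MeasurableSpace Ω] [MeasurableSpace E] (P : Measure Ω)
    (X : ℕ → Ω → E) (u : ℝ) : ℝ≥0∞ :=
  ⨅ (m : ℕ) (_ : mixingCoeff P X m ≤ u), (m : ℝ≥0∞)

/-- The shift on sequences. -/
def shift {E : Type*} (x : ℕ → E) : ℕ → E := fun i => x (i + 1)

/-- The process `X` is stationary: its law on the sequence space is invariant under the shift. -/
def IsStationary {Ω E : Type*} [MeasurableSpace Ω] [MeasurableSpace E] (P : Measure Ω)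
    (X : ℕ → Ω → E) : Prop :=
  P.map (fun ω => shift (fun i => X i ω)) = P.map (fun ω i => X i ω)

/-- The function `g` of a sequence depends only on the first `N` coordinates. -/
def DependsOnFirst {E Y : Type*} (g : (ℕ → E) → Y) (N : ℕ) : Prop :=
  ∀ z z' : ℕ → E, (∀ i < N, z i = z' i) → g z = g z'

/-! ### The deterministic and the random measures -/

/-- The law of `S_n Φ(X) / n`. -/
def scaledLaw {Ω E Y : Type*} [MeasurableSpace Ω] [NormedAddCommGroup Y] [NormedSpace ℝ Y]
    [MeasurableSpace Y] (P : Measure Ω) (X : ℕ → Ω → E) (SΦ : ℕ → (ℕ → E) → Y) (n : ℕ) :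
    Measure Y :=
  P.map (fun ω => (n : ℝ)⁻¹ • SΦ n (fun i => X i ω))

/-- The empirical measure of the points `S_n Φ(T^{(j-1)n} x) / n`, `1 ≤ j ≤ k(n)`, along the
sequence `x` (the summation index below is `j - 1`). -/
def empiricalLaw {E Y : Type*} [NormedAddCommGroup Y] [NormedSpace ℝ Y] [MeasurableSpace Y]
    (SΦ : ℕ → (ℕ → E) → Y) (k : ℕ → ℕ) (x : ℕ → E) (n : ℕ) : Measure Y :=
  (k n : ℝ≥0∞)⁻¹ • ∑ j ∈ Finset.range (k n),
    Measure.dirac ((n : ℝ)⁻¹ • SΦ n (shift^[j * n] x))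

/-! ### Logarithmic moment generating functions and convex duality.
Functions with values in `ℝ ∪ {±∞}` are `EReal`-valued; `ENNReal.log` takes the values
`log 0 = -∞` and `log ∞ = ∞`. -/

/-- `(1/n) log ∫ exp (n ⟨l, x⟩) dμ(x)`. -/
def logMGF {d : ℕ} (μ : Measure (EuclideanSpace ℝ (Fin d))) (n : ℕ)
    (l : EuclideanSpace ℝ (Fin d)) : EReal :=
  ENNReal.log (∫⁻ x, ENNReal.ofReal (Real.exp (n * inner ℝ l x)) ∂μ) / (n : EReal)

/-- The domain `{l : L l < ∞}`. -/
def effDomain {Y : Type*} (L : Y → EReal) : Set Y := {l | L l < ⊤}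

/-- The Fenchel-Legendre transform. -/
def fenchel {d : ℕ} (L : EuclideanSpace ℝ (Fin d) → EReal) (x : EuclideanSpace ℝ (Fin d)) :
    EReal :=
  ⨆ l : EuclideanSpace ℝ (Fin d), ((inner ℝ l x : ℝ) : EReal) - L l

/-- The exposed points of the Fenchel-Legendre transform of `L` that have an exposing hyperplane
in the interior of the domain of `L`. -/
def exposedPoints {d : ℕ} (L : EuclideanSpace ℝ (Fin d) → EReal) :
    Set (EuclideanSpace ℝ (Fin d)) :=
  {y | ∃ l ∈ interior (effDomain L), ∀ x, x ≠ y →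
    ((inner ℝ l x : ℝ) : EReal) - fenchel L x < ((inner ℝ l y : ℝ) : EReal) - fenchel L y}

/-- Essential smoothness of a function with values in `ℝ ∪ {∞}`: the interior of the domain is
non-empty, the function is differentiable there, and it is steep. -/
structure EssentiallySmooth {d : ℕ} (L : EuclideanSpace ℝ (Fin d) → EReal) : Prop where
  nonempty : (interior (effDomain L)).Nonempty
  differentiable : ∀ l ∈ interior (effDomain L), DifferentiableAt ℝ (fun z => (L z).toReal) l
  steep : ∀ (u : ℕ → EuclideanSpace ℝ (Fin d)) (l : EuclideanSpace ℝ (Fin d)),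
    (∀ n, u n ∈ interior (effDomain L)) → l ∈ frontier (interior (effDomain L)) →
    Tendsto u atTop (𝓝 l) →
    Tendsto (fun n => ‖gradient (fun z => (L z).toReal) (u n)‖) atTop atTop

/-! ### Large deviation principles -/

/-- `I` is a good rate function: it is lower semicontinuous with values in `[0,∞]`, and its level
sets are compact. -/
structure IsGoodRateFunction {Y : Type*} [TopologicalSpace Y] (I : Y → EReal) : Prop where
  nonneg : ∀ x, 0 ≤ I x
  lowerSemicontinuous : LowerSemicontinuous I
  isCompact_level : ∀ a : ℝ, 0 ≤ a → IsCompact {x | I x ≤ (a : EReal)}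

/-- The large deviation bounds with rate function `I` for the sequence `(μ n)`, `n ≥ 1`, over all
sets of the completed Borel sigma-algebra. -/
def SatisfiesLDP {Y : Type*} [TopologicalSpace Y] [MeasurableSpace Y] (μ : ℕ → Measure Y)
    (I : Y → EReal) : Prop :=
  ∀ Γ : Set Y, (∀ n, 1 ≤ n → NullMeasurableSet Γ (μ n)) →
    -(⨅ x ∈ interior Γ, I x) ≤ liminf (fun n : ℕ => ENNReal.log (μ n Γ) / (n : EReal)) atTop ∧
    limsup (fun n : ℕ => ENNReal.log (μ n Γ) / (n : EReal)) atTop ≤ -(⨅ x ∈ closure Γ, I x)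

end LocalFluctuations

end

open LocalFluctuations

/-! Everything reduces to one claim: for each fixed `l` in the interior of the domain of `Λ`, almost
surely `Λ_n^ω(l) → Λ(l)`. Apply it on a countable dense set. Since each `Λ_n^ω` is convex,
convergence there gives locally uniform convergence on the interior, outside a single null set. The
large deviation bounds are then deterministic: a Gärtner-Ellis theorem that assumes convergence on
the interior only, `limsup_le_of_isClosed` and `le_liminf_of_isOpen`.

The pointwise upper bound is Markov's inequality, because by stationarity the empirical exponential
moment has mean `exp(n Λ_n(l))`. For the lower bound, write `r = Λ(l)`, `s = Λ(p l)` with `p > 1`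
close to `1`, and truncate `exp ⟨l, S_n Φ⟩` at `exp(n b)`. The moment of order `p` shows that the
mean is hardly changed once `(p-1) b > s - r`. Chebyshev's inequality for about `exp(n κ)` weakly
dependent blocks works once `κ > b - r`. Such a `b` exists when `s - p r < (p-1) κ`. As `p ↓ 1`, if
`Λ` is differentiable at `l`, the quotient `(s - p r)/(p-1)` tends to `⟨l, ∇Λ(l)⟩ - Λ(l) =
Λ*(∇Λ(l))`, which is where `sup Λ*` enters. `exists_moment_gap` uses subgradients instead, so no
differentiability is needed. Mixing enters through polynomial decay of every order: blocks `exp(n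
δ)` apart have covariances smaller than any prescribed exponential rate.

If `Λ` is essentially smooth and lower semicontinuous, a Moreau-Yosida approximation places, near
each point where `Λ*` is finite, an exposed point at which `Λ*` is not larger. The lower bound over
exposed points is then the full one. -/

namespace LocalFluctuations

/-! ### Exponential rates -/

lemma log_ofReal_exp (x : ℝ) : ENNReal.log (ENNReal.ofReal (Real.exp x)) = x := by
  rw [ENNReal.log_ofReal_of_pos (Real.exp_pos x), Real.log_exp]

/-- This lemma and its variants turn exponential rates into comparisons with `exp(n A)`, so that the
estimates avoid arithmetic in `EReal`. -/
lemma log_div_le_iff {z : ℝ≥0∞} {n : ℕ} (hn : 1 ≤ n) {A : ℝ} :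
    ENNReal.log z / (n : EReal) ≤ (A : EReal) ↔ z ≤ ENNReal.ofReal (Real.exp (n * A)) := by
  rw [EReal.div_le_iff_le_mul (by exact_mod_cast hn) (EReal.natCast_ne_top n),
    ← ENNReal.log_strictMono.le_iff_le (a := z), log_ofReal_exp]
  push_cast
  rfl

lemma le_log_div_iff {z : ℝ≥0∞} {n : ℕ} (hn : 1 ≤ n) {A : ℝ} :
    (A : EReal) ≤ ENNReal.log z / (n : EReal) ↔ ENNReal.ofReal (Real.exp (n * A)) ≤ z := by
  rw [EReal.le_div_iff_mul_le (by exact_mod_cast hn) (EReal.natCast_ne_top n),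
    ← ENNReal.log_strictMono.le_iff_le (b := z), log_ofReal_exp, mul_comm]
  push_cast
  rfl

lemma lt_log_div_iff {z : ℝ≥0∞} {n : ℕ} (hn : 1 ≤ n) {A : ℝ} :
    (A : EReal) < ENNReal.log z / (n : EReal) ↔ ENNReal.ofReal (Real.exp (n * A)) < z := by
  rw [← not_le, log_div_le_iff hn, not_le]

lemma log_div_lt_iff {z : ℝ≥0∞} {n : ℕ} (hn : 1 ≤ n) {A : ℝ} :
    ENNReal.log z / (n : EReal) < (A : EReal) ↔ z < ENNReal.ofReal (Real.exp (n * A)) := by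
  rw [← not_le, le_log_div_iff hn, not_le]

lemma tendsto_log_div_of_eventually {z : ℕ → ℝ≥0∞} {r : ℝ}
    (hu : ∀ ε : ℝ, 0 < ε → ∀ᶠ n : ℕ in atTop, z n ≤ ENNReal.ofReal (Real.exp (n * (r + ε))))
    (hl : ∀ ε : ℝ, 0 < ε → ∀ᶠ n : ℕ in atTop, ENNReal.ofReal (Real.exp (n * (r - ε))) ≤ z n) :
    Tendsto (fun n : ℕ => ENNReal.log (z n) / (n : EReal)) atTop (𝓝 (r : EReal)) := by
  rw [tendsto_order]
  constructor
  · intro a ha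
    obtain ⟨b, hab, hbr⟩ := EReal.lt_iff_exists_real_btwn.1 ha
    have hbr' : b < r := by exact_mod_cast hbr
    filter_upwards [hl (r - b) (by linarith), eventually_ge_atTop 1] with n hn h1
    refine hab.trans_le ((le_log_div_iff h1).2 ?_)
    rwa [sub_sub_cancel] at hn
  · intro a ha
    obtain ⟨b, hrb, hba⟩ := EReal.lt_iff_exists_real_btwn.1 ha
    have hbr' : r < b := by exact_mod_cast hrb
    filter_upwards [hu (b - r) (by linarith), eventually_ge_atTop 1] with n hn h1
    refine ((log_div_le_iff h1).2 ?_).trans_lt hba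
    rwa [add_sub_cancel] at hn

lemma eventually_lt_exp_of_tendsto {z : ℕ → ℝ≥0∞} {v : EReal}
    (h : Tendsto (fun n : ℕ => ENNReal.log (z n) / (n : EReal)) atTop (𝓝 v)) {A : ℝ}
    (hA : v < A) : ∀ᶠ n : ℕ in atTop, z n < ENNReal.ofReal (Real.exp (n * A)) := by
  filter_upwards [h.eventually_lt_const hA, eventually_ge_atTop 1] with n hn h1
  exact (log_div_lt_iff h1).1 hn

lemma eventually_exp_lt_of_tendsto {z : ℕ → ℝ≥0∞} {v : EReal}
    (h : Tendsto (fun n : ℕ => ENNReal.log (z n) / (n : EReal)) atTop (𝓝 v)) {A : ℝ}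
    (hA : A < v) : ∀ᶠ n : ℕ in atTop, ENNReal.ofReal (Real.exp (n * A)) < z n := by
  filter_upwards [h.eventually_const_lt hA, eventually_ge_atTop 1] with n hn h1
  exact (lt_log_div_iff h1).1 hn

/-- The function `n ↦ n c` eventually exceeds any constant, for `c > 0`. -/
lemma eventually_const_le_nat_mul {c : ℝ} (hc : 0 < c) (C : ℝ) :
    ∀ᶠ n : ℕ in atTop, C ≤ n * c :=
  (tendsto_natCast_atTop_atTop.atTop_mul_const hc).eventually_ge_atTop C

lemma eventually_const_mul_exp_le (C : ℝ) {a b : ℝ} (hab : a < b) :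
    ∀ᶠ n : ℕ in atTop, C * Real.exp (n * a) ≤ Real.exp (n * b) := by
  filter_upwards [eventually_const_le_nat_mul (sub_pos.2 hab) C] with n hn
  have h : Real.exp (n * b) = Real.exp (n * (b - a)) * Real.exp (n * a) := by
    rw [← Real.exp_add]; ring_nf
  rw [h]
  gcongr
  linarith [Real.add_one_le_exp ((n : ℝ) * (b - a))]

/-! ### Exponential moments -/

section ExpMoment

variable {d : ℕ} {μ : Measure (EuclideanSpace ℝ (Fin d))} {n : ℕ}

/-- The exponential moment `∫ exp (n ⟨l, x⟩) dμ(x)`. -/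
noncomputable def expMoment (μ : Measure (EuclideanSpace ℝ (Fin d))) (n : ℕ)
    (l : EuclideanSpace ℝ (Fin d)) : ℝ≥0∞ :=
  ∫⁻ x, ENNReal.ofReal (Real.exp (n * inner ℝ l x)) ∂μ

lemma logMGF_eq (μ : Measure (EuclideanSpace ℝ (Fin d))) (n : ℕ) (l : EuclideanSpace ℝ (Fin d)) :
    logMGF μ n l = ENNReal.log (expMoment μ n l) / (n : EReal) := rfl

lemma expMoment_zero (μ : Measure (EuclideanSpace ℝ (Fin d))) [IsProbabilityMeasure μ] (n : ℕ) :
    expMoment μ n 0 = 1 := by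
  simp [expMoment]

/-- Hölder's inequality; the convexity of `Λ_n^ω` and of `Λ` comes from here. -/
lemma expMoment_combo_le (μ : Measure (EuclideanSpace ℝ (Fin d))) (n : ℕ)
    (l m : EuclideanSpace ℝ (Fin d)) {a b : ℝ} (ha : 0 ≤ a) (hb : 0 ≤ b) (hab : a + b = 1) :
    expMoment μ n (a • l + b • m) ≤ expMoment μ n l ^ a * expMoment μ n m ^ b := by
  refine le_trans (le_of_eq ?_)
    (ENNReal.lintegral_mul_norm_pow_le (μ := μ) (by fun_prop) (by fun_prop) ha hb hab)
  refine lintegral_congr fun x => ?_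
  rw [ENNReal.ofReal_rpow_of_pos (Real.exp_pos _), ENNReal.ofReal_rpow_of_pos (Real.exp_pos _),
    ← ENNReal.ofReal_mul (by positivity), ← Real.exp_mul, ← Real.exp_mul, ← Real.exp_add,
    inner_add_left, real_inner_smul_left, real_inner_smul_left]
  ring_nf

lemma expMoment_combo_le_exp {l m : EuclideanSpace ℝ (Fin d)} {a b A B : ℝ}
    (ha : 0 ≤ a) (hb : 0 ≤ b) (hab : a + b = 1)
    (hl : expMoment μ n l ≤ ENNReal.ofReal (Real.exp (n * A)))
    (hm : expMoment μ n m ≤ ENNReal.ofReal (Real.exp (n * B))) :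
    expMoment μ n (a • l + b • m) ≤ ENNReal.ofReal (Real.exp (n * (a * A + b * B))) := by
  refine (expMoment_combo_le μ n l m ha hb hab).trans ?_
  refine (mul_le_mul' (ENNReal.rpow_le_rpow hl ha) (ENNReal.rpow_le_rpow hm hb)).trans ?_
  rw [ENNReal.ofReal_rpow_of_pos (Real.exp_pos _), ENNReal.ofReal_rpow_of_pos (Real.exp_pos _),
    ← ENNReal.ofReal_mul (by positivity), ← Real.exp_mul, ← Real.exp_mul, ← Real.exp_add]
  exact le_of_eq (by ring_nf)

end ExpMoment

/-! ### The limiting logarithmic moment generating function -/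

/-- `L` is convex as a function with values in `[-∞, ∞]`. -/
def IsEConvex {Y : Type*} [AddCommGroup Y] [Module ℝ Y] (L : Y → EReal) : Prop :=
  ∀ (l m : Y) (a b A B : ℝ), 0 ≤ a → 0 ≤ b → a + b = 1 → L l < A → L m < B →
    L (a • l + b • m) ≤ ((a * A + b * B : ℝ) : EReal)

lemma isEConvex_of_tendsto_logMGF {d : ℕ} {μ : ℕ → Measure (EuclideanSpace ℝ (Fin d))}
    {L : EuclideanSpace ℝ (Fin d) → EReal}
    (h : ∀ l, Tendsto (fun n : ℕ => logMGF (μ n) n l) atTop (𝓝 (L l))) : IsEConvex L := by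
  intro l m a b A B ha hb hab hA hB
  refine le_of_tendsto (h _) ?_
  filter_upwards [eventually_lt_exp_of_tendsto (h l) hA, eventually_lt_exp_of_tendsto (h m) hB,
    eventually_ge_atTop 1] with n h1 h2 hn
  exact (log_div_le_iff hn).2 (expMoment_combo_le_exp ha hb hab h1.le h2.le)

namespace IsEConvex

section

variable {Y : Type*} [AddCommGroup Y] [Module ℝ Y] {L : Y → EReal}

lemma convex_effDomain (h : IsEConvex L) : Convex ℝ (effDomain L) := by
  intro l hl m hm a b ha hb hab
  obtain ⟨A, hA, -⟩ := EReal.lt_iff_exists_real_btwn.1 (show L l < ⊤ from hl)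
  obtain ⟨B, hB, -⟩ := EReal.lt_iff_exists_real_btwn.1 (show L m < ⊤ from hm)
  exact (h l m a b A B ha hb hab hA hB).trans_lt (EReal.coe_lt_top _)

lemma convexOn_toReal (h : IsEConvex L) (hbot : ∀ l, L l ≠ ⊥) :
    ConvexOn ℝ (effDomain L) (fun l => (L l).toReal) := by
  refine ⟨h.convex_effDomain, fun l hl m hm a b ha hb hab => ?_⟩
  have key : ∀ l ∈ effDomain L, L l = ((L l).toReal : EReal) := fun l hl =>
    (EReal.coe_toReal (ne_of_lt hl) (hbot l)).symm
  refine le_of_forall_pos_le_add fun ε hε => ?_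
  have h1 := h l m a b ((L l).toReal + ε) ((L m).toReal + ε) ha hb hab
    (by conv_lhs => rw [key l hl]
        exact_mod_cast lt_add_of_pos_right _ hε)
    (by conv_lhs => rw [key m hm]
        exact_mod_cast lt_add_of_pos_right _ hε)
  rw [key _ (h.convex_effDomain hl hm ha hb hab), EReal.coe_le_coe_iff] at h1
  have h2 : a * ε + b * ε = ε := by rw [← add_mul, hab, one_mul]
  simp only [smul_eq_mul]
  linarith

end

variable {Y : Type*} [NormedAddCommGroup Y] [NormedSpace ℝ Y] {L : Y → EReal}

/-- The origin lies strictly between `l` and `-t l`, which is in the domain for small `t > 0`. A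
value `-∞` at `l` would force `L 0 < 0`. -/
lemma ne_bot (h : IsEConvex L) (h0 : L 0 = 0) (hint : (0 : Y) ∈ interior (effDomain L)) (l : Y) :
    L l ≠ ⊥ := by
  intro hl
  have hcont : Tendsto (fun t : ℝ => -(t • l)) (𝓝[>] 0) (𝓝 (0 : Y)) := by
    have : Continuous fun t : ℝ => -(t • l) := by fun_prop
    exact (this.tendsto' 0 0 (by simp)).mono_left nhdsWithin_le_nhds
  obtain ⟨t, ht, ht0 : (0 : ℝ) < t⟩ :=
    ((hcont.eventually (mem_interior_iff_mem_nhds.1 hint)).and self_mem_nhdsWithin).exists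
  obtain ⟨B, hB, -⟩ := EReal.lt_iff_exists_real_btwn.1 (show L (-(t • l)) < ⊤ from ht)
  -- The bound `-(|B| + 1) / t` at `l` is chosen to outweigh the bound `B` at `-t l` in the convex
  -- combination.
  have h1 := h l (-(t • l)) (t / (1 + t)) (1 / (1 + t)) (-(|B| + 1) / t) B (by positivity)
    (by positivity) (by field_simp; ring) (by rw [hl]; exact EReal.bot_lt_coe _) hB
  have h2 : (t / (1 + t)) • l + (1 / (1 + t)) • -(t • l) = 0 := by
    rw [smul_neg, smul_smul, one_div_mul_eq_div, add_neg_cancel]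
  rw [h2, h0, ← EReal.coe_zero, EReal.coe_le_coe_iff] at h1
  have h3 : t / (1 + t) * (-(|B| + 1) / t) + 1 / (1 + t) * B = (B - (|B| + 1)) / (1 + t) := by
    field_simp; ring
  rw [h3] at h1
  have h4 : (B - (|B| + 1)) / (1 + t) < 0 :=
    div_neg_of_neg_of_pos (by linarith [le_abs_self B]) (by positivity)
  linarith

/-- Multiples `t l`, `0 ≤ t < 1`, of the points of the domain are interior. -/
lemma smul_mem_interior (h : IsEConvex L) (hint : (0 : Y) ∈ interior (effDomain L)) {l : Y}
    (hl : l ∈ effDomain L) {t : ℝ} (ht0 : 0 ≤ t) (ht : t < 1) :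
    t • l ∈ interior (effDomain L) := by
  have := h.convex_effDomain.combo_interior_self_mem_interior hint hl (sub_pos.2 ht) ht0
    (by ring)
  simpa using this

end IsEConvex

/-- In the Legendre transform of a convex function that vanishes at an interior point `0` of its
domain, only the interior of the domain matters. -/
lemma IsEConvex.exists_mem_interior_lt {d : ℕ} {L : EuclideanSpace ℝ (Fin d) → EReal}
    (h : IsEConvex L) (h0 : L 0 = 0) (hint : (0 : EuclideanSpace ℝ (Fin d)) ∈ interior (effDomain L))
    {x : EuclideanSpace ℝ (Fin d)} {c : ℝ} (hc : (c : EReal) < fenchel L x) :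
    ∃ l ∈ interior (effDomain L), c < inner ℝ l x - (L l).toReal := by
  obtain ⟨l, hl⟩ := lt_iSup_iff.1 hc
  have hbot := h.ne_bot h0 hint
  have hlD : l ∈ effDomain L := by
    rw [effDomain, Set.mem_ofPred_eq, lt_top_iff_ne_top]
    intro htop
    rw [htop] at hl
    simp at hl
  have key : ∀ l ∈ effDomain L, L l = ((L l).toReal : EReal) := fun l hl =>
    (EReal.coe_toReal (ne_of_lt hl) (hbot l)).symm
  rw [key l hlD] at hl
  have hl' : c < inner ℝ l x - (L l).toReal := by exact_mod_cast hl
  -- Since `L 0 = 0`, convexity gives `L(t l) ≤ t L(l)`, so the objective at `t l` is at least `t`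
  -- times the objective at `l`; take `t < 1` close to `1`.
  have hcont : Tendsto (fun t : ℝ => t * (inner ℝ l x - (L l).toReal)) (𝓝[<] 1)
      (𝓝 (inner ℝ l x - (L l).toReal)) := by
    have : Continuous fun t : ℝ => t * (inner ℝ l x - (L l).toReal) := by fun_prop
    exact (this.tendsto' 1 _ (by simp)).mono_left nhdsWithin_le_nhds
  obtain ⟨t, ⟨ht, ht1 : t < 1⟩, ht0⟩ := (((hcont.eventually_const_lt hl').and
    self_mem_nhdsWithin).and (nhdsWithin_le_nhds (Ioi_mem_nhds one_pos))).exists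
  have ht0' : (0 : ℝ) < t := ht0
  refine ⟨t • l, h.smul_mem_interior hint hlD ht0'.le ht1, ?_⟩
  have h1 := (h.convexOn_toReal hbot).2 (interior_subset hint) hlD (sub_pos.2 ht1).le ht0'.le
    (by ring)
  simp only [smul_zero, zero_add, h0, EReal.toReal_zero, smul_eq_mul] at h1
  rw [real_inner_smul_left]
  linarith

/-! ### Convex functions on finite-dimensional spaces -/

section Convex

variable {V : Type*} [NormedAddCommGroup V] [NormedSpace ℝ V] [FiniteDimensional ℝ V]

/-- A convex set with non-empty interior has the same interior as its closure. The hull of `Q` has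
non-empty interior because `Q` spans: its affine span is closed and contains the open set `U`. -/
lemma subset_convexHull_of_subset_closure {U Q : Set V} (hU : IsOpen U) (hUQ : U ⊆ closure Q) :
    U ⊆ convexHull ℝ Q := by
  rcases U.eq_empty_or_nonempty with rfl | hne
  · exact Set.empty_subset _
  have hspan : affineSpan ℝ Q = ⊤ := by
    have hcl : closure Q ⊆ affineSpan ℝ Q :=
      closure_minimal (subset_affineSpan ℝ Q) (AffineSubspace.closed_of_finiteDimensional _)
    rw [eq_top_iff, ← hU.affineSpan_eq_top hne]
    exact affineSpan_le.2 (hUQ.trans hcl)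
  have hint := interior_convexHull_nonempty_iff_affineSpan_eq_top.2 hspan
  have h1 : U ⊆ interior (closure (convexHull ℝ Q)) :=
    interior_maximal (hUQ.trans (closure_mono (subset_convexHull ℝ Q))) hU
  rw [(convex_convexHull ℝ Q).interior_closure_eq_interior_of_nonempty_interior hint] at h1
  exact h1.trans interior_subset

/-- If convex functions converge on a dense subset of an open set, then they are eventually
uniformly Lipschitz near each point. -/
lemma eventually_lipschitzOnWith_of_tendsto_dense {U Q : Set V} (hU : IsOpen U)
    (hQU : Q ⊆ U) (hUQ : U ⊆ closure Q) {f : ℕ → V → ℝ} {g : V → ℝ}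
    (hf : ∀ᶠ n in atTop, ConvexOn ℝ U (f n))
    (hlim : ∀ q ∈ Q, Tendsto (fun n => f n q) atTop (𝓝 (g q))) {x : V} (hx : x ∈ U) :
    ∃ K : NNReal, ∃ s ∈ 𝓝 x, s ⊆ U ∧ ∀ᶠ n in atTop, LipschitzOnWith K (f n) s := by
  -- pointwise upper bounds
  have hbdd : ∀ y ∈ U, ∃ M : ℝ, ∀ᶠ n in atTop, f n y ≤ M := by
    have hUc : Convex ℝ U := by
      obtain ⟨n, hn⟩ := hf.exists
      exact hn.1
    have hconv : Convex ℝ {y | y ∈ U ∧ ∃ M : ℝ, ∀ᶠ n in atTop, f n y ≤ M} := by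
      rintro y ⟨hy, M, hM⟩ z ⟨hz, N, hN⟩ a b ha hb hab
      refine ⟨hUc hy hz ha hb hab, a * M + b * N, ?_⟩
      filter_upwards [hf, hM, hN] with n h1 h2 h3
      refine (h1.2 hy hz ha hb hab).trans ?_
      simp only [smul_eq_mul]
      gcongr
    have hsub : Q ⊆ {y | y ∈ U ∧ ∃ M : ℝ, ∀ᶠ n in atTop, f n y ≤ M} := fun q hq =>
      ⟨hQU hq, g q + 1, (hlim q hq).eventually_le_const (by linarith)⟩
    exact fun y hy => (convexHull_min hsub hconv (subset_convexHull_of_subset_closure hU hUQ hy)).2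
  -- a uniform upper bound near `x`
  obtain ⟨b, hxb, hbU⟩ := exists_mem_interior_convexHull_affineBasis (hU.mem_nhds hx)
  have hbU' : ∀ i, b i ∈ U := fun i => hbU (subset_convexHull ℝ _ (Set.mem_range_self i))
  choose M hM using fun i => hbdd (b i) (hbU' i)
  obtain ⟨M', hM'⟩ := (Set.finite_range M).bddAbove
  have hup : ∀ᶠ n in atTop, ∀ y ∈ convexHull ℝ (Set.range b), f n y ≤ M' := by
    filter_upwards [hf, eventually_all.2 hM] with n hn h2 y hy
    obtain ⟨z, hz, hyz⟩ := (hn.subset hbU (convex_convexHull ℝ _)).exists_ge_of_mem_convexHull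
      (subset_convexHull ℝ _) hy
    obtain ⟨i, rfl⟩ := hz
    exact hyz.trans ((h2 i).trans (hM' (Set.mem_range_self i)))
  obtain ⟨ρ, hρ, hball⟩ := Metric.mem_nhds_iff.1 (mem_interior_iff_mem_nhds.1 hxb)
  -- A lower bound is known only at points of `Q`, so the ball is re-centred at some `q ∈ Q` near
  -- `x`.
  obtain ⟨q, hq, hqx⟩ := Metric.mem_closure_iff.1 (hUQ hx) (ρ / 4) (by linarith)
  have hqball : Metric.ball q (ρ / 2) ⊆ convexHull ℝ (Set.range b) := by
    refine (Metric.ball_subset_ball' ?_).trans hball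
    rw [dist_comm] at hqx
    linarith
  have hqU : Metric.ball q (ρ / 2) ⊆ U := hqball.trans hbU
  refine ⟨(2 * (|M'| + 2 * (|g q| + 1)) / (ρ / 4)).toNNReal, Metric.ball q (ρ / 2 - ρ / 4),
    Metric.isOpen_ball.mem_nhds (by rw [Metric.mem_ball]; linarith),
    (Metric.ball_subset_ball (by linarith)).trans hqU, ?_⟩
  filter_upwards [hf, hup, (hlim q hq).eventually_const_le (show g q - 1 < g q by linarith)]
    with n hn hM hlow
  refine (hn.subset hqU (convex_ball _ _)).lipschitzOnWith_of_abs_le (by linarith) fun a ha => ?_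
  have ha' : a ∈ Metric.ball q (ρ / 2) := ha
  -- The midpoint of `a` and its reflection is `q`, so `f a ≥ 2 f q - f (2q - a)` turns the upper
  -- bound into a lower one.
  have hr : (2 : ℝ) • q - a ∈ Metric.ball q (ρ / 2) := by
    rw [mem_ball_iff_norm] at ha' ⊢
    rw [two_smul, show q + q - a - q = -(a - q) by abel, norm_neg]
    exact ha'
  have hmid := hn.2 (hqU ha') (hqU hr) (show (0 : ℝ) ≤ 1 / 2 by norm_num)
    (show (0 : ℝ) ≤ 1 / 2 by norm_num) (by norm_num)
  have hq2 : (1 / 2 : ℝ) • a + (1 / 2 : ℝ) • ((2 : ℝ) • q - a) = q := by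
    rw [smul_sub, smul_smul]
    norm_num
  rw [hq2] at hmid
  simp only [smul_eq_mul] at hmid
  have h1 := hM a (hqball ha')
  have h2 := hM _ (hqball hr)
  rw [abs_le]
  constructor
  · linarith [neg_abs_le (g q), le_abs_self M']
  · linarith [abs_nonneg (g q), le_abs_self M']

/-- Convex functions that converge on a dense subset of an open set to a continuous
function converge uniformly on its compact subsets. -/
lemma tendstoUniformlyOn_of_tendsto_dense {U Q : Set V} (hU : IsOpen U)
    (hQU : Q ⊆ U) (hUQ : U ⊆ closure Q) {f : ℕ → V → ℝ} {g : V → ℝ}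
    (hf : ∀ᶠ n in atTop, ConvexOn ℝ U (f n)) (hg : ContinuousOn g U)
    (hlim : ∀ q ∈ Q, Tendsto (fun n => f n q) atTop (𝓝 (g q))) {K : Set V} (hK : IsCompact K)
    (hKU : K ⊆ U) : TendstoUniformlyOn f g atTop K := by
  refine (tendstoLocallyUniformlyOn_iff_forall_isCompact hU).1 ?_ K hKU hK
  rw [Metric.tendstoLocallyUniformlyOn_iff]
  intro ε hε x hx
  obtain ⟨C, s, hs, hsU, hLip⟩ := eventually_lipschitzOnWith_of_tendsto_dense hU hQU hUQ hf hlim hx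
  have hgx := hg.continuousAt (hU.mem_nhds hx)
  obtain ⟨δ, hδ, hδs⟩ := Metric.mem_nhds_iff.1
    (inter_mem hs (hgx.preimage_mem_nhds (Metric.ball_mem_nhds (g x) (show 0 < ε / 8 by linarith))))
  set η : ℝ := min δ (ε / (8 * (C + 1))) with hη
  have hηpos : 0 < η := lt_min hδ (by positivity)
  obtain ⟨q, hq, hxq⟩ := Metric.mem_closure_iff.1 (hUQ hx) η hηpos
  refine ⟨Metric.ball x η, mem_nhdsWithin_of_mem_nhds (Metric.ball_mem_nhds x hηpos), ?_⟩
  filter_upwards [hLip, (hlim q hq).eventually (Metric.ball_mem_nhds _ (show 0 < ε / 8 by linarith))]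
    with n h1 h2 y hy
  have hyδ := hδs (Metric.ball_subset_ball (min_le_left _ _) hy)
  have hqδ := hδs (Metric.ball_subset_ball (min_le_left _ _) (by rwa [Metric.mem_ball, dist_comm]))
  have h3 : dist (f n y) (f n q) ≤ C * dist y q := h1.dist_le_mul y hyδ.1 q hqδ.1
  have h4 : dist y q ≤ 2 * η := by
    rw [Metric.mem_ball] at hy
    linarith [dist_triangle y x q]
  have h5 : C * dist y q ≤ ε / 4 := by
    have hC : (0 : ℝ) ≤ C := C.2
    have hη2 : η ≤ ε / (8 * (C + 1)) := min_le_right _ _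
    rw [le_div_iff₀ (by positivity)] at hη2
    nlinarith
  have h6 : dist (g y) (g x) < ε / 8 := hyδ.2
  have h7 : dist (g q) (g x) < ε / 8 := hqδ.2
  have h8 : dist (f n q) (g q) < ε / 8 := h2
  calc dist (g y) (f n y) ≤ dist (g y) (g x) + dist (g x) (g q) + dist (g q) (f n q)
        + dist (f n q) (f n y) := by
        linarith [dist_triangle4 (g y) (g x) (g q) (f n y), dist_triangle (g q) (f n q) (f n y)]
    _ < ε := by
        rw [dist_comm (g x), dist_comm (g q) (f n q), dist_comm (f n q) (f n y)]
        linarith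

/-- Subgradients of convex functions on open sets exist. -/
lemma exists_subgradient {V : Type*} [NormedAddCommGroup V] [InnerProductSpace ℝ V]
    [FiniteDimensional ℝ V] {U : Set V} (hU : IsOpen U) {f : V → ℝ}
    (hf : ConvexOn ℝ U f) {x : V} (hx : x ∈ U) :
    ∃ v : V, ∀ y ∈ U, f x + inner ℝ v (y - x) ≤ f y := by
  have hcont := hf.continuousOn hU
  have hopen : IsOpen {p : V × ℝ | p.1 ∈ U ∧ f p.1 < p.2} := by
    have h1 : ContinuousOn (fun p : V × ℝ => p.2 - f p.1) (Prod.fst ⁻¹' U) :=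
      continuousOn_snd.sub (hcont.comp continuousOn_fst fun p hp => hp)
    have h2 := h1.isOpen_inter_preimage (hU.preimage continuous_fst) (isOpen_Ioi (a := (0 : ℝ)))
    convert h2 using 1
    ext p
    simp
  -- Separate `(x, f x)` from the open strict epigraph; the slope of the separating hyperplane is
  -- the subgradient.
  obtain ⟨L, hL⟩ := geometric_hahn_banach_open_point hf.convex_strict_epigraph hopen
    (x := (x, f x)) (by simp)
  have hsplit : ∀ (y : V) (t : ℝ), L (y, t) = L (y, 0) + t * L (0, 1) := by
    intro y t
    have h1 : ((y, t) : V × ℝ) = (y, 0) + t • ((0, 1) : V × ℝ) := by simp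
    rw [h1, map_add, map_smul, smul_eq_mul]
  -- The hyperplane is not vertical, as the point `(x, f x + 1)` above `x` shows.
  have hs : L (0, 1) < 0 := by
    have h1 := hL (x, f x + 1) ⟨hx, by simp⟩
    rw [hsplit, hsplit x (f x)] at h1
    linarith
  have hle : ∀ y ∈ U, L (y, 0) + f y * L (0, 1) ≤ L (x, 0) + f x * L (0, 1) := by
    intro y hy
    have h1 : Tendsto (fun t : ℝ => L (y, 0) + t * L (0, 1)) (𝓝[>] (f y))
        (𝓝 (L (y, 0) + f y * L (0, 1))) := by
      have : Continuous fun t : ℝ => L (y, 0) + t * L (0, 1) := by fun_prop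
      exact (this.tendsto _).mono_left nhdsWithin_le_nhds
    refine le_of_tendsto h1 ?_
    filter_upwards [self_mem_nhdsWithin] with t ht
    have h2 := hL (y, t) ⟨hy, ht⟩
    rw [hsplit, hsplit x (f x)] at h2
    exact h2.le
  refine ⟨(InnerProductSpace.toDual ℝ V).symm
    ((-(L (0, 1))⁻¹) • L.comp (ContinuousLinearMap.inl ℝ V ℝ)), fun y hy => ?_⟩
  rw [InnerProductSpace.toDual_symm_apply]
  have h1 : ((y - x, 0) : V × ℝ) = (y, 0) - (x, 0) := by simp
  have h2 : L (y - x, 0) = L (y, 0) - L (x, 0) := by rw [h1, map_sub]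
  simp only [_root_.smul_apply, ContinuousLinearMap.comp_apply,
    ContinuousLinearMap.inl_apply, smul_eq_mul, h2]
  have h3 := hle y hy
  have h4 : (f x - f y) * L (0, 1) ≥ L (y, 0) - L (x, 0) := by linarith
  have h5 := mul_le_mul_of_nonneg_left h4 (show 0 ≤ -(L (0, 1))⁻¹ by
    rw [neg_nonneg, inv_nonpos]; exact hs.le)
  have h6 : -(L (0, 1))⁻¹ * ((f x - f y) * L (0, 1)) = f y - f x := by
    field_simp [hs.ne]
    ring
  rw [h6] at h5
  linarith

end Convex

/-! ### Large deviation bounds from convergence of the generating functions -/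

section GartnerEllis

variable {d : ℕ}

lemma norm_le_sum_abs (x : EuclideanSpace ℝ (Fin d)) : ‖x‖ ≤ ∑ i, |x i| := by
  conv_lhs => rw [← (EuclideanSpace.basisFun (Fin d) ℝ).sum_repr x]
  refine (norm_sum_le _ _).trans (Finset.sum_le_sum fun i _ => ?_)
  simp [norm_smul]

/-- Polars of neighbourhoods of the origin are bounded, even if only finitely many points of the
neighbourhood are used. -/
lemma exists_finset_isBounded {U : Set (EuclideanSpace ℝ (Fin d))}
    (hU : U ∈ 𝓝 (0 : EuclideanSpace ℝ (Fin d))) (b : EuclideanSpace ℝ (Fin d) → ℝ) :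
    ∃ T : Finset (EuclideanSpace ℝ (Fin d)), (∀ l ∈ T, l ∈ U) ∧
      Bornology.IsBounded {x : EuclideanSpace ℝ (Fin d) | ∀ l ∈ T, inner ℝ l x ≤ b l} := by
  classical
  obtain ⟨r, hr, hball⟩ := Metric.mem_nhds_iff.1 hU
  set e : Fin d → EuclideanSpace ℝ (Fin d) := fun i => EuclideanSpace.single i (1 : ℝ)
  set δ := r / 2 with hδ
  have hδ0 : 0 < δ := by positivity
  have hmem : ∀ i, δ • e i ∈ U ∧ -(δ • e i) ∈ U := by
    intro i
    constructor <;> apply hball <;>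
      simp [e, norm_smul, abs_of_pos hδ0] <;> rw [hδ] <;> linarith
  refine ⟨Finset.univ.image (fun i => δ • e i) ∪ Finset.univ.image (fun i => -(δ • e i)), ?_, ?_⟩
  · intro l hl
    simp only [Finset.mem_union, Finset.mem_image, Finset.mem_univ, true_and] at hl
    rcases hl with ⟨i, rfl⟩ | ⟨i, rfl⟩
    exacts [(hmem i).1, (hmem i).2]
  · rw [isBounded_iff_forall_norm_le]
    refine ⟨∑ i, max (b (δ • e i)) (b (-(δ • e i))) / δ, fun x hx => ?_⟩
    refine (norm_le_sum_abs x).trans (Finset.sum_le_sum fun i _ => ?_)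
    have h1 := hx (δ • e i) (by simp)
    have h2 := hx (-(δ • e i)) (by simp)
    have h3 : inner ℝ (e i) x = x i := by simp [e, EuclideanSpace.inner_single_left]
    rw [real_inner_smul_left, h3] at h1
    rw [inner_neg_left, real_inner_smul_left, h3] at h2
    rw [le_div_iff₀ hδ0, mul_comm, ← abs_of_pos hδ0, ← abs_mul, abs_of_pos hδ0]
    exact abs_le.2 ⟨by linarith [le_max_right (b (δ • e i)) (b (-(δ • e i)))],
      h1.trans (le_max_left _ _)⟩

lemma measure_halfspace_le {ρ : Measure (EuclideanSpace ℝ (Fin d))} {n : ℕ}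
    {l : EuclideanSpace ℝ (Fin d)} {A B : ℝ}
    (h : expMoment ρ n l ≤ ENNReal.ofReal (Real.exp (n * A))) :
    ρ {x | B < inner ℝ l x} ≤ ENNReal.ofReal (Real.exp (n * (A - B))) := by
  have h1 : ENNReal.ofReal (Real.exp (n * B)) * ρ {x | B < inner ℝ l x} ≤ expMoment ρ n l := by
    refine le_trans ?_ (mul_meas_ge_le_lintegral (by fun_prop) (ENNReal.ofReal (Real.exp (n * B))))
    gcongr with x
    intro hx
    gcongr
  have h2 : ρ {x | B < inner ℝ l x} = ENNReal.ofReal (Real.exp (n * -B)) *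
      (ENNReal.ofReal (Real.exp (n * B)) * ρ {x | B < inner ℝ l x}) := by
    rw [← mul_assoc, ← ENNReal.ofReal_mul (by positivity), ← Real.exp_add]
    simp
  rw [h2, show (n : ℝ) * (A - B) = n * -B + n * A by ring, Real.exp_add,
    ENNReal.ofReal_mul (by positivity)]
  gcongr
  exact h1.trans h

/-- Half-spaces of Chernoff rate better than `c` cover `F`. Finitely many with slopes near `0` leave
only a bounded part, and compactness handles the rest. The measures need not be normalised and the
gain `c' > c` is strict, so that the lemma also applies to tilted measures. -/
lemma eventually_measure_le_exp {ρ : ℕ → Measure (EuclideanSpace ℝ (Fin d))}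
    {U : Set (EuclideanSpace ℝ (Fin d))} (hU : U ∈ 𝓝 (0 : EuclideanSpace ℝ (Fin d)))
    {L : EuclideanSpace ℝ (Fin d) → ℝ}
    (hL : ∀ l ∈ U, ∀ ε : ℝ, 0 < ε →
      ∀ᶠ n : ℕ in atTop, expMoment (ρ n) n l ≤ ENNReal.ofReal (Real.exp (n * (L l + ε))))
    {F : Set (EuclideanSpace ℝ (Fin d))} (hF : IsClosed F) {c : ℝ}
    (hc : ∀ x ∈ F, ∃ l ∈ U, c < inner ℝ l x - L l) :
    ∃ c' : ℝ, c < c' ∧ ∀ᶠ n : ℕ in atTop, ρ n F ≤ ENNReal.ofReal (Real.exp (n * -c')) := by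
  classical
  set V : EuclideanSpace ℝ (Fin d) × ℝ → Set (EuclideanSpace ℝ (Fin d)) :=
    fun p => {x | L p.1 + p.2 < inner ℝ p.1 x} with hV
  have hVo : ∀ p, IsOpen (V p) := fun p => isOpen_lt continuous_const (by fun_prop)
  obtain ⟨T₀, hT₀U, hT₀⟩ := exists_finset_isBounded hU (fun l => L l + (c + 1))
  have hcomp : IsCompact (F ∩ {x | ∀ l ∈ T₀, inner ℝ l x ≤ L l + (c + 1)}) := by
    refine Metric.isCompact_of_isClosed_isBounded (hF.inter ?_)
      (hT₀.subset Set.inter_subset_right)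
    simp only [Set.ofPred_forall]
    exact isClosed_biInter fun l _ => isClosed_le (by fun_prop) continuous_const
  obtain ⟨T₁, hT₁⟩ := hcomp.elim_finite_subcover
    (fun p : {p : EuclideanSpace ℝ (Fin d) × ℝ // p.1 ∈ U ∧ c < p.2} => V p)
    (fun p => hVo p) (by
      rintro x ⟨hx, -⟩
      obtain ⟨l, hl, hlx⟩ := hc x hx
      obtain ⟨c', h1, h2⟩ := exists_between hlx
      exact Set.mem_iUnion.2 ⟨⟨(l, c'), hl, h1⟩, by simp only [hV, Set.mem_ofPred_eq]; linarith⟩)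
  set T : Finset (EuclideanSpace ℝ (Fin d) × ℝ) :=
    T₀.image (fun l => (l, c + 1)) ∪ T₁.image Subtype.val with hT
  have hTU : ∀ p ∈ T, p.1 ∈ U ∧ c < p.2 := by
    intro p hp
    simp only [hT, Finset.mem_union, Finset.mem_image] at hp
    rcases hp with ⟨l, hl, rfl⟩ | ⟨q, -, rfl⟩
    · exact ⟨hT₀U l hl, by simp⟩
    · exact q.2
  have hcover : F ⊆ ⋃ p ∈ T, V p := by
    intro x hx
    by_cases h : ∀ l ∈ T₀, inner ℝ l x ≤ L l + (c + 1)
    · obtain ⟨q, hq, hxq⟩ := Set.mem_iUnion₂.1 (hT₁ ⟨hx, h⟩)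
      exact Set.mem_iUnion₂.2 ⟨q, Finset.mem_union_right _ (Finset.mem_image_of_mem _ hq), hxq⟩
    · push Not at h
      obtain ⟨l, hl, hlx⟩ := h
      exact Set.mem_iUnion₂.2 ⟨(l, c + 1),
        Finset.mem_union_left _ (Finset.mem_image_of_mem _ hl), hlx⟩
  -- All finitely many rates exceed a common `c₂ > c`. Stopping halfway between `c` and `c₂` absorbs
  -- the number of half-spaces.
  obtain ⟨c₂, hc₂, hcc₂ : c < c₂⟩ := ((T.eventually_all.2 fun p hp =>
    nhdsWithin_le_nhds (Iio_mem_nhds (hTU p hp).2) :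
      ∀ᶠ c' in 𝓝[>] c, ∀ p ∈ T, c' < p.2).and self_mem_nhdsWithin).exists
  refine ⟨(c + c₂) / 2, by linarith, ?_⟩
  have hev : ∀ᶠ n : ℕ in atTop, ∀ p ∈ T, ρ n (V p) ≤ ENNReal.ofReal (Real.exp (n * -c₂)) := by
    rw [T.eventually_all]
    intro p hp
    filter_upwards [hL p.1 (hTU p hp).1 (p.2 - c₂) (sub_pos.2 (hc₂ p hp))] with n hn
    refine (measure_halfspace_le hn).trans (le_of_eq ?_)
    ring_nf
  filter_upwards [hev, eventually_const_mul_exp_le (T.card : ℝ)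
    (show -c₂ < -((c + c₂) / 2) by linarith)] with n hn hcard
  calc ρ n F ≤ ρ n (⋃ p ∈ T, V p) := measure_mono hcover
    _ ≤ ∑ p ∈ T, ρ n (V p) := measure_biUnion_finset_le _ _
    _ ≤ ∑ p ∈ T, ENNReal.ofReal (Real.exp (n * -c₂)) := Finset.sum_le_sum hn
    _ = ENNReal.ofReal (T.card * Real.exp (n * -c₂)) := by
        rw [Finset.sum_const, nsmul_eq_mul, ENNReal.ofReal_mul (by positivity),
          ENNReal.ofReal_natCast]
    _ ≤ _ := ENNReal.ofReal_le_ofReal hcard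

lemma coe_toReal_of_mem_effDomain {Y : Type*} {L : Y → EReal} {l : Y} (hl : l ∈ effDomain L)
    (hbot : L l ≠ ⊥) : ((L l).toReal : EReal) = L l :=
  EReal.coe_toReal (ne_of_lt (show L l < ⊤ from hl)) hbot

variable {ν : ℕ → Measure (EuclideanSpace ℝ (Fin d))} {Λ : EuclideanSpace ℝ (Fin d) → EReal}

/-- The large deviation upper bound for closed sets. -/
lemma limsup_le_of_isClosed (hconv : IsEConvex Λ) (h0 : Λ 0 = 0)
    (hint : (0 : EuclideanSpace ℝ (Fin d)) ∈ interior (effDomain Λ))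
    (hlim : ∀ l ∈ interior (effDomain Λ),
      Tendsto (fun n : ℕ => logMGF (ν n) n l) atTop (𝓝 (Λ l)))
    {F : Set (EuclideanSpace ℝ (Fin d))} (hF : IsClosed F) :
    limsup (fun n : ℕ => ENNReal.log (ν n F) / (n : EReal)) atTop ≤ -(⨅ x ∈ F, fenchel Λ x) := by
  by_contra! hlt
  obtain ⟨b, hb1, hb2⟩ := EReal.lt_iff_exists_real_btwn.1 hlt
  have hb : ((-b : ℝ) : EReal) < ⨅ x ∈ F, fenchel Λ x := by
    rw [EReal.coe_neg]
    exact EReal.neg_lt_comm.1 hb1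
  have hbot := hconv.ne_bot h0 hint
  obtain ⟨c', hc', hev⟩ := eventually_measure_le_exp (ρ := ν) (L := fun l => (Λ l).toReal)
    (isOpen_interior.mem_nhds hint) (by
      intro l hl ε hε
      have h1 : Λ l < (((Λ l).toReal + ε : ℝ) : EReal) := by
        conv_lhs => rw [← coe_toReal_of_mem_effDomain (interior_subset hl) (hbot l)]
        exact_mod_cast lt_add_of_pos_right _ hε
      exact (eventually_lt_exp_of_tendsto (hlim l hl) h1).mono fun n hn => hn.le) hF
    (fun x hx => hconv.exists_mem_interior_lt h0 hint (hb.trans_le (iInf₂_le x hx)))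
  refine absurd hb2 (not_lt.2 ?_)
  refine limsup_le_of_le (by isBoundedDefault) ?_
  filter_upwards [hev, eventually_ge_atTop 1] with n hn h1
  refine ((log_div_le_iff h1).2 hn).trans ?_
  exact_mod_cast (by linarith : -c' ≤ b)

lemma expMoment_withDensity (μ : Measure (EuclideanSpace ℝ (Fin d))) (n : ℕ)
    (l m : EuclideanSpace ℝ (Fin d)) :
    expMoment (μ.withDensity fun x => ENNReal.ofReal (Real.exp (n * inner ℝ l x))) n m =
      expMoment μ n (l + m) := by
  rw [expMoment, lintegral_withDensity_eq_lintegral_mul _ (by fun_prop) (by fun_prop)]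
  refine lintegral_congr fun x => ?_
  rw [Pi.mul_apply, ← ENNReal.ofReal_mul (by positivity), ← Real.exp_add, inner_add_left]
  ring_nf

/-- The cost of undoing the exponential tilt on a small ball. -/
lemma withDensity_ball_le (μ : Measure (EuclideanSpace ℝ (Fin d))) (n : ℕ)
    (l y : EuclideanSpace ℝ (Fin d)) (δ : ℝ) :
    (μ.withDensity fun x => ENNReal.ofReal (Real.exp (n * inner ℝ l x))) (Metric.ball y δ) ≤
      ENNReal.ofReal (Real.exp (n * (inner ℝ l y + ‖l‖ * δ))) * μ (Metric.ball y δ) := by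
  rw [withDensity_apply _ measurableSet_ball, ← setLIntegral_const]
  refine setLIntegral_mono measurable_const fun x hx => ?_
  gcongr
  have h1 : inner ℝ l x = inner ℝ l y + inner ℝ l (x - y) := by rw [← inner_add_right]; simp
  rw [h1]
  gcongr
  refine (real_inner_le_norm _ _).trans ?_
  gcongr
  exact (mem_ball_iff_norm.1 hx).le

/-- The large deviation lower bound for open sets, with exposed points only. -/
lemma le_liminf_of_isOpen (hconv : IsEConvex Λ) (h0 : Λ 0 = 0)
    (hint : (0 : EuclideanSpace ℝ (Fin d)) ∈ interior (effDomain Λ))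
    (hlim : ∀ l ∈ interior (effDomain Λ),
      Tendsto (fun n : ℕ => logMGF (ν n) n l) atTop (𝓝 (Λ l)))
    {G : Set (EuclideanSpace ℝ (Fin d))} (hG : IsOpen G) :
    -(⨅ x ∈ G ∩ exposedPoints Λ, fenchel Λ x) ≤
      liminf (fun n : ℕ => ENNReal.log (ν n G) / (n : EReal)) atTop := by
  rw [EReal.neg_le]
  refine le_iInf₂ fun y hy => ?_
  rw [EReal.neg_le]
  obtain ⟨hyG, l, hl, hexp⟩ := hy
  have hbot := hconv.ne_bot h0 hint
  have hreal : ∀ l ∈ interior (effDomain Λ), Λ l = ((Λ l).toReal : EReal) := fun l hl =>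
    (coe_toReal_of_mem_effDomain (interior_subset hl) (hbot l)).symm
  set r := (Λ l).toReal with hr
  refine le_of_forall_lt fun a ha => ?_
  obtain ⟨a', haa', ha'⟩ := EReal.lt_iff_exists_real_btwn.1 ha
  refine haa'.trans_le ?_
  -- the Legendre transform at `y` bounds the affine function of the exposing point
  have hle : ((inner ℝ l y : ℝ) : EReal) - r ≤ fenchel Λ y := by
    rw [hr, ← hreal l hl]
    exact le_iSup (fun l => ((inner ℝ l y : ℝ) : EReal) - Λ l) l
  have har : a' < r - inner ℝ l y := by
    have h1 : (a' : EReal) < -(((inner ℝ l y : ℝ) : EReal) - r) :=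
      ha'.trans_le (EReal.neg_le_neg_iff.2 hle)
    have h2 : a' < -(inner ℝ l y - r) := by exact_mod_cast h1
    linarith
  set γ := r - inner ℝ l y - a' with hγ
  have hγ0 : 0 < γ := by linarith
  obtain ⟨δ₀, hδ₀, hball⟩ := Metric.isOpen_iff.1 hG y hyG
  set δ := min δ₀ (γ / (4 * (‖l‖ + 1))) with hδ
  have hδpos : 0 < δ := lt_min hδ₀ (by positivity)
  have hδγ : ‖l‖ * δ ≤ γ / 4 := by
    have h1 : δ ≤ γ / (4 * (‖l‖ + 1)) := min_le_right _ _
    rw [le_div_iff₀ (by positivity)] at h1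
    nlinarith [norm_nonneg l]
  set ρ : ℕ → Measure (EuclideanSpace ℝ (Fin d)) := fun n =>
    (ν n).withDensity fun x => ENNReal.ofReal (Real.exp (n * inner ℝ l x)) with hρ
  have hUmem : {m | l + m ∈ interior (effDomain Λ)} ∈ 𝓝 (0 : EuclideanSpace ℝ (Fin d)) := by
    have : Continuous fun m : EuclideanSpace ℝ (Fin d) => l + m := by fun_prop
    exact (isOpen_interior.preimage this).mem_nhds (by simpa using hl)
  -- The tilted measure has total mass about `exp(n r)`. The exposing property says that off `y` the
  -- transform of `Λ(l + ·)`, which is `Λ*(x) - ⟨l, x⟩`, exceeds `-r`. The complement of the ball is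
  -- therefore exponentially negligible, and the ball carries the mass.
  obtain ⟨c', hc', hev⟩ := eventually_measure_le_exp (ρ := ρ) (L := fun m => (Λ (l + m)).toReal)
    (F := (Metric.ball y δ)ᶜ) (c := -r) hUmem (by
      intro m hm ε hε
      have h1 : Λ (l + m) < (((Λ (l + m)).toReal + ε : ℝ) : EReal) := by
        conv_lhs => rw [hreal _ hm]
        exact_mod_cast lt_add_of_pos_right _ hε
      refine (eventually_lt_exp_of_tendsto (hlim _ hm) h1).mono fun n hn => ?_
      rw [hρ, expMoment_withDensity]
      exact hn.le) Metric.isOpen_ball.isClosed_compl (by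
      intro x hx
      have hxy : x ≠ y := by
        rintro rfl
        exact hx (Metric.mem_ball_self hδpos)
      have h1 : ((inner ℝ l x : ℝ) : EReal) - fenchel Λ x < r := by
        refine (hexp x hxy).trans_le ?_
        rw [EReal.sub_le_iff_le_add (by simp) (by simp)] at hle ⊢
        rwa [add_comm]
      have h2 : ((inner ℝ l x - r : ℝ) : EReal) < fenchel Λ x := by
        push_cast
        rw [EReal.sub_lt_iff (by simp) (by simp)] at h1 ⊢
        rwa [add_comm]
      obtain ⟨m, hm, hmx⟩ := hconv.exists_mem_interior_lt h0 hint h2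
      refine ⟨m - l, by simpa using hm, ?_⟩
      rw [inner_sub_left, add_sub_cancel]
      linarith)
  set ε := min (γ / 4) ((c' + r) / 4) with hε
  have hε0 : 0 < ε := lt_min (by linarith) (by linarith)
  have hlower := eventually_exp_lt_of_tendsto (hlim l hl) (A := r - ε) (by
    rw [hreal l hl, EReal.coe_lt_coe_iff]
    linarith)
  refine le_liminf_of_le (by isBoundedDefault) ?_
  filter_upwards [hev, hlower, eventually_ge_atTop 1,
    eventually_const_mul_exp_le 2 (show -c' < r - ε by
      linarith [min_le_right (γ / 4) ((c' + r) / 4)]),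
    eventually_const_mul_exp_le 2 (show r - 2 * ε < r - ε by linarith)] with n h1 h2 hn h3 h4
  rw [le_log_div_iff hn]
  have hsub : Metric.ball y δ ⊆ G := (Metric.ball_subset_ball (min_le_left _ _)).trans hball
  refine le_trans ?_ (measure_mono hsub)
  have htot : ENNReal.ofReal (Real.exp (n * (r - ε))) ≤
      ρ n (Metric.ball y δ) + ENNReal.ofReal (Real.exp (n * -c')) := by
    calc ENNReal.ofReal (Real.exp (n * (r - ε))) ≤ expMoment (ν n) n l := h2.le
      _ = ρ n Set.univ := by rw [hρ, withDensity_apply _ MeasurableSet.univ, setLIntegral_univ]; rfl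
      _ ≤ ρ n (Metric.ball y δ) + ρ n (Metric.ball y δ)ᶜ := by
          rw [← Set.union_compl_self (Metric.ball y δ)]
          exact measure_union_le _ _
      _ ≤ _ := by gcongr
  have h5 : ENNReal.ofReal (Real.exp (n * (r - 2 * ε))) ≤ ρ n (Metric.ball y δ) := by
    refine le_trans ?_ (tsub_le_iff_right.2 htot)
    rw [← ENNReal.ofReal_sub _ (by positivity)]
    exact ENNReal.ofReal_le_ofReal (by linarith)
  have h6 := h5.trans (withDensity_ball_le (ν n) n l y δ)
  calc ENNReal.ofReal (Real.exp (n * a'))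
      ≤ ENNReal.ofReal (Real.exp (n * -(inner ℝ l y + ‖l‖ * δ))) *
          ENNReal.ofReal (Real.exp (n * (r - 2 * ε))) := by
        rw [← ENNReal.ofReal_mul (by positivity), ← Real.exp_add, ← mul_add]
        refine ENNReal.ofReal_le_ofReal (Real.exp_le_exp.2 ?_)
        gcongr
        linarith [min_le_left (γ / 4) ((c' + r) / 4)]
    _ ≤ ENNReal.ofReal (Real.exp (n * -(inner ℝ l y + ‖l‖ * δ))) *
          (ENNReal.ofReal (Real.exp (n * (inner ℝ l y + ‖l‖ * δ))) *
            ν n (Metric.ball y δ)) := by gcongr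
    _ = ν n (Metric.ball y δ) := by
        rw [← mul_assoc, ← ENNReal.ofReal_mul (by positivity), ← Real.exp_add, ← mul_add,
          neg_add_cancel]
        simp

end GartnerEllis

/-! ### Convex duality for essentially smooth functions -/

section Gradient

variable {V : Type*} [NormedAddCommGroup V] [InnerProductSpace ℝ V] [CompleteSpace V]

lemma add_inner_gradient_le {D : Set V} {f : V → ℝ} (hf : ConvexOn ℝ D f) {p x : V}
    (hp : p ∈ D) (hx : x ∈ D) (hd : DifferentiableAt ℝ f p) :
    f p + inner ℝ (gradient f p) (x - p) ≤ f x := by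
  have h1 : HasDerivAt (fun t : ℝ => p + t • (x - p)) (x - p) 0 := by
    simpa using ((hasDerivAt_id (0 : ℝ)).smul_const (x - p)).const_add p
  have h2 : HasDerivAt (fun t : ℝ => f (p + t • (x - p))) (inner ℝ (gradient f p) (x - p)) 0 := by
    have h3 : HasFDerivAt f (InnerProductSpace.toDual ℝ V (gradient f p)) (p + (0 : ℝ) • (x - p)) := by
      simpa using hd.hasGradientAt.hasFDerivAt
    simpa using! h3.comp_hasDerivAt (0 : ℝ) h1
  have h4 := h2.tendsto_slope_zero_right
  have h5 : inner ℝ (gradient f p) (x - p) ≤ f x - f p := by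
    refine le_of_tendsto h4 ?_
    filter_upwards [Ioo_mem_nhdsGT (zero_lt_one' ℝ)] with t ht
    have h6 := hf.2 hp hx (sub_nonneg.2 ht.2.le) ht.1.le (by ring)
    have h7 : (1 - t) • p + t • x = p + t • (x - p) := by
      rw [smul_sub, sub_smul, one_smul]; abel
    rw [h7] at h6
    simp only [smul_eq_mul, zero_add, zero_smul, add_zero] at h6 ⊢
    rw [inv_mul_le_iff₀ ht.1]
    linarith
  linarith

lemma gradient_eq_of_isLocalMin_sub_inner {f : V → ℝ} {l x : V} (hd : DifferentiableAt ℝ f l)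
    (h : IsLocalMin (fun m => f m - inner ℝ x m) l) : gradient f l = x := by
  have h1 : HasFDerivAt (fun m => f m - inner ℝ x m)
      (InnerProductSpace.toDual ℝ V (gradient f l) - InnerProductSpace.toDual ℝ V x) l :=
    hd.hasGradientAt.hasFDerivAt.sub (InnerProductSpace.toDual ℝ V x).hasFDerivAt
  have h2 := h.hasFDerivAt_eq_zero h1
  exact (InnerProductSpace.toDual ℝ V).injective (sub_eq_zero.1 h2)

lemma gradient_eq_of_isLocalMin_add_norm_sq {f : V → ℝ} {l y : V} {ε : ℝ}
    (hd : DifferentiableAt ℝ f l)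
    (h : IsLocalMin (fun m => f m + (ε / 2 * ‖m‖ ^ 2 - inner ℝ y m)) l) :
    gradient f l = y - ε • l := by
  have h1 : HasFDerivAt (fun m => f m + (ε / 2 * ‖m‖ ^ 2 - inner ℝ y m))
      (InnerProductSpace.toDual ℝ V (gradient f l) +
        ((ε / 2) • (2 • InnerProductSpace.toDual ℝ V l) - InnerProductSpace.toDual ℝ V y)) l :=
    hd.hasGradientAt.hasFDerivAt.add
      (((hasStrictFDerivAt_norm_sq l).hasFDerivAt.const_mul (ε / 2)).sub
        (InnerProductSpace.toDual ℝ V y).hasFDerivAt)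
  have h2 := h.hasFDerivAt_eq_zero h1
  refine ext_inner_right ℝ fun v => ?_
  have h3 := DFunLike.congr_fun h2 v
  simp only [_root_.add_apply, _root_.sub_apply, _root_.smul_apply,
    InnerProductSpace.toDual_apply_apply, _root_.zero_apply, smul_eq_mul, nsmul_eq_mul] at h3
  rw [inner_sub_left, real_inner_smul_left]
  push_cast at h3
  linarith

/-- A minimiser of a quadratic perturbation of a steep convex function is an interior point of the
domain. -/
lemma mem_interior_of_isMinOn_of_steep [FiniteDimensional ℝ V] {D : Set V} {f : V → ℝ}
    (hf : ConvexOn ℝ D f) (h0 : (0 : V) ∈ interior D)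
    (hd : ∀ l ∈ interior D, DifferentiableAt ℝ f l)
    (hsteep : ∀ (u : ℕ → V) (l : V), (∀ n, u n ∈ interior D) → l ∈ frontier (interior D) →
      Tendsto u atTop (𝓝 l) → Tendsto (fun n => ‖gradient f (u n)‖) atTop atTop)
    {ε : ℝ} (hε : 0 ≤ ε) {y l : V} (hl : l ∈ D)
    (hmin : ∀ m ∈ D, f l + (ε / 2 * ‖l‖ ^ 2 - inner ℝ y l) ≤
      f m + (ε / 2 * ‖m‖ ^ 2 - inner ℝ y m)) : l ∈ interior D := by
  by_contra hli
  set t : ℕ → ℝ := fun n => 1 - 1 / ((n : ℝ) + 1 + 1) with ht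
  have ht0 : ∀ n, 0 ≤ t n := fun n => by
    have : 1 / ((n : ℝ) + 1 + 1) ≤ 1 := by
      rw [div_le_one (by positivity)]
      linarith [n.cast_nonneg (α := ℝ)]
    simp only [ht]
    linarith
  have ht1 : ∀ n, t n < 1 := fun n => by
    have : 0 < 1 / ((n : ℝ) + 1 + 1) := by positivity
    simp only [ht]
    linarith
  have htlim : Tendsto t atTop (𝓝 1) := by
    have h1 := (tendsto_one_div_add_atTop_nhds_zero_nat (𝕜 := ℝ)).comp (tendsto_add_atTop_nat 1)
    have h2 := h1.const_sub 1
    rw [sub_zero] at h2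
    refine h2.congr fun n => ?_
    simp [ht]
  have hu : ∀ n, t n • l ∈ interior D := fun n => by
    simpa using hf.1.combo_interior_self_mem_interior h0 hl (sub_pos.2 (ht1 n)) (ht0 n) (by ring)
  have hulim : Tendsto (fun n => t n • l) atTop (𝓝 l) := by
    simpa using htlim.smul_const l
  have hfr : l ∈ frontier (interior D) :=
    ⟨mem_closure_of_tendsto hulim (Eventually.of_forall hu), by rwa [interior_interior]⟩
  have hinf := hsteep _ l hu hfr hulim
  obtain ⟨r, hr, hball⟩ := Metric.nhds_basis_closedBall.mem_iff.1 (isOpen_interior.mem_nhds h0)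
  obtain ⟨M, hM⟩ := ((isCompact_closedBall (0 : V) r).image_of_continuousOn
    (hf.continuousOn_interior.mono hball)).bddAbove
  -- Approaching `l` along the ray from `0`, the gradients stay bounded, against steepness. The
  -- gradient inequality tested on a ball around `0` bounds `r ‖v‖` by `M - f p + ⟨v, p⟩`, and
  -- minimality at `l` controls both `f p` and `⟨v, l⟩`.
  have hbound : ∀ n, r * ‖gradient f (t n • l)‖ ≤
      M + (ε / 2 * ‖l‖ ^ 2 + ‖y‖ * ‖l‖) - (f l + (ε / 2 * ‖l‖ ^ 2 - inner ℝ y l))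
        + |inner ℝ y l| := by
    intro n
    set p := t n • l with hp
    set v := gradient f p with hv
    have hpD : p ∈ D := interior_subset (hu n)
    -- When `v = 0` the convention `r / 0 = 0` makes this the origin.
    have hη : (r / ‖v‖) • v ∈ Metric.closedBall (0 : V) r := by
      rw [mem_closedBall_zero_iff, norm_smul, norm_div, norm_norm, Real.norm_of_nonneg hr.le]
      rcases eq_or_ne ‖v‖ 0 with h | h
      · simp [h, hr.le]
      · rw [div_mul_cancel₀ _ h]
    have h1 := add_inner_gradient_le hf hpD (interior_subset (hball hη)) (hd p (hu n))
    have h2 : f ((r / ‖v‖) • v) ≤ M := hM (Set.mem_image_of_mem f hη)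
    have h3 : inner ℝ v ((r / ‖v‖) • v) = r * ‖v‖ := by
      rw [real_inner_smul_right, real_inner_self_eq_norm_sq]
      rcases eq_or_ne ‖v‖ 0 with h | h
      · simp [h]
      · field_simp
    rw [← hv, inner_sub_right, h3] at h1
    have h4 := add_inner_gradient_le hf hpD hl (hd p (hu n))
    have h5 := hmin p hpD
    have h6 : l - p = (1 - t n) • l := by rw [sub_smul, one_smul]
    have hnp : ‖p‖ = t n * ‖l‖ := by rw [hp, norm_smul, Real.norm_of_nonneg (ht0 n)]
    have hyp : inner ℝ y p = t n * inner ℝ y l := by rw [hp, real_inner_smul_right]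
    have hvp : inner ℝ v p = t n * inner ℝ v l := by rw [hp, real_inner_smul_right]
    rw [← hv, h6, real_inner_smul_right] at h4
    have hsq : ‖p‖ ^ 2 ≤ ‖l‖ ^ 2 := by
      rw [hnp]
      exact pow_le_pow_left₀ (mul_nonneg (ht0 n) (norm_nonneg _))
        (mul_le_of_le_one_left (norm_nonneg _) (ht1 n).le) 2
    have hsq' : ε / 2 * ‖p‖ ^ 2 ≤ ε / 2 * ‖l‖ ^ 2 := by gcongr
    -- The quadratic term has the favourable sign because `‖p‖ ≤ ‖l‖`; divide by `1 - t n > 0`.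
    have h7 : inner ℝ v l ≤ inner ℝ y l := by
      have h8 : (1 - t n) * inner ℝ v l ≤ (1 - t n) * inner ℝ y l := by
        rw [hyp] at h5
        linarith
      exact le_of_mul_le_mul_left h8 (sub_pos.2 (ht1 n))
    have h9 : inner ℝ v p ≤ |inner ℝ y l| := by
      rw [hvp]
      calc t n * inner ℝ v l ≤ t n * |inner ℝ y l| := by
            gcongr
            · exact ht0 n
            · exact h7.trans (le_abs_self _)
        _ ≤ 1 * |inner ℝ y l| := by gcongr; exact (ht1 n).le
        _ = _ := one_mul _
    have h10 : -inner ℝ y p ≤ ‖y‖ * ‖l‖ := by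
      have h11 := abs_real_inner_le_norm y p
      have h12 : ‖y‖ * ‖p‖ ≤ ‖y‖ * ‖l‖ := by
        gcongr
        rw [hnp]
        exact mul_le_of_le_one_left (norm_nonneg _) (ht1 n).le
      linarith [neg_abs_le (inner ℝ y p)]
    linarith
  obtain ⟨n, hn⟩ := (hinf.eventually_gt_atTop ((M + (ε / 2 * ‖l‖ ^ 2 + ‖y‖ * ‖l‖) -
    (f l + (ε / 2 * ‖l‖ ^ 2 - inner ℝ y l)) + |inner ℝ y l|) / r)).exists
  rw [div_lt_iff₀ hr, mul_comm] at hn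
  linarith [hbound n]

end Gradient

section Duality

variable {d : ℕ} {Λ : EuclideanSpace ℝ (Fin d) → EReal}

lemma le_fenchel (Λ : EuclideanSpace ℝ (Fin d) → EReal) (l x : EuclideanSpace ℝ (Fin d)) :
    ((inner ℝ l x : ℝ) : EReal) - Λ l ≤ fenchel Λ x :=
  le_iSup (fun l => ((inner ℝ l x : ℝ) : EReal) - Λ l) l

lemma fenchel_nonneg (h0 : Λ 0 = 0) (x : EuclideanSpace ℝ (Fin d)) : 0 ≤ fenchel Λ x := by
  simpa [h0] using le_fenchel Λ 0 x

lemma le_fenchel_toReal (hbot : ∀ l, Λ l ≠ ⊥) {l : EuclideanSpace ℝ (Fin d)}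
    (hl : l ∈ effDomain Λ) (x : EuclideanSpace ℝ (Fin d)) :
    ((inner ℝ l x - (Λ l).toReal : ℝ) : EReal) ≤ fenchel Λ x := by
  have h := le_fenchel Λ l x
  rwa [← coe_toReal_of_mem_effDomain hl (hbot l), ← EReal.coe_sub] at h

lemma fenchel_le_of_forall (hbot : ∀ l, Λ l ≠ ⊥) {x : EuclideanSpace ℝ (Fin d)} {c : ℝ}
    (h : ∀ l ∈ effDomain Λ, inner ℝ l x - (Λ l).toReal ≤ c) : fenchel Λ x ≤ c := by
  refine iSup_le fun l => ?_
  by_cases hl : l ∈ effDomain Λ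
  · rw [← coe_toReal_of_mem_effDomain hl (hbot l), ← EReal.coe_sub]
    exact_mod_cast h l hl
  · have htop : Λ l = ⊤ := by
      by_contra hne
      exact hl (lt_top_iff_ne_top.2 hne)
    rw [htop, EReal.sub_top]
    exact bot_le

lemma lowerSemicontinuous_fenchel (hbot : ∀ l, Λ l ≠ ⊥) : LowerSemicontinuous (fenchel Λ) := by
  refine lowerSemicontinuous_iSup fun l => Continuous.lowerSemicontinuous ?_
  by_cases hl : l ∈ effDomain Λ
  · have heq : (fun x : EuclideanSpace ℝ (Fin d) => ((inner ℝ l x : ℝ) : EReal) - Λ l) =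
        fun x => ((inner ℝ l x - (Λ l).toReal : ℝ) : EReal) := by
      funext x
      rw [EReal.coe_sub, coe_toReal_of_mem_effDomain hl (hbot l)]
    rw [heq]
    exact continuous_coe_real_ereal.comp (by fun_prop)
  · have htop : Λ l = ⊤ := by
      by_contra hne
      exact hl (lt_top_iff_ne_top.2 hne)
    simp only [htop, EReal.sub_top]
    exact continuous_const

/-- The Legendre transform of a function finite near the origin is a good rate function. -/
lemma isGoodRateFunction_fenchel (hbot : ∀ l, Λ l ≠ ⊥) (h0 : Λ 0 = 0)
    (hint : (0 : EuclideanSpace ℝ (Fin d)) ∈ interior (effDomain Λ)) :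
    IsGoodRateFunction (fenchel Λ) where
  nonneg := fenchel_nonneg h0
  lowerSemicontinuous := lowerSemicontinuous_fenchel hbot
  isCompact_level := by
    intro a _
    refine Metric.isCompact_of_isClosed_isBounded
      ((lowerSemicontinuous_fenchel hbot).isClosed_preimage (a : EReal)) ?_
    obtain ⟨T, hT, hb⟩ := exists_finset_isBounded (mem_interior_iff_mem_nhds.1 hint)
      (fun l => (Λ l).toReal + a)
    refine hb.subset fun x hx l hl => ?_
    have h1 := (le_fenchel_toReal hbot (hT l hl) x).trans hx
    have h2 : inner ℝ l x - (Λ l).toReal ≤ a := by exact_mod_cast h1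
    linarith

/-- Moreau-Yosida approximation: the points of the domain of the Legendre transform of an
essentially smooth function are limits of exposed points at which the transform is not larger. -/
lemma exists_mem_exposedPoints_norm_sub_sq_le (hconv : IsEConvex Λ) (h0 : Λ 0 = 0)
    (hint : (0 : EuclideanSpace ℝ (Fin d)) ∈ interior (effDomain Λ))
    (hsm : EssentiallySmooth Λ) (hlsc : LowerSemicontinuous Λ)
    {y : EuclideanSpace ℝ (Fin d)} (hy : fenchel Λ y ≠ ⊤) {ε : ℝ} (hε : 0 < ε) :
    ∃ z ∈ exposedPoints Λ, fenchel Λ z ≤ fenchel Λ y ∧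
      ‖z - y‖ ^ 2 ≤ ε * (fenchel Λ y).toReal := by
  have hbot := hconv.ne_bot h0 hint
  set f : EuclideanSpace ℝ (Fin d) → ℝ := fun l => (Λ l).toReal with hf
  have hreal : ∀ l ∈ effDomain Λ, (f l : EReal) = Λ l := fun l hl =>
    coe_toReal_of_mem_effDomain hl (hbot l)
  have hfconv : ConvexOn ℝ (effDomain Λ) f := hconv.convexOn_toReal hbot
  set s := (fenchel Λ y).toReal with hs
  have hs0 : 0 ≤ s := EReal.toReal_nonneg (fenchel_nonneg h0 y)
  have hsy : (s : EReal) = fenchel Λ y :=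
    EReal.coe_toReal hy (ne_bot_of_le_ne_bot (by simp) (fenchel_nonneg h0 y))
  have hfs : ∀ l ∈ effDomain Λ, inner ℝ y l - f l ≤ s := by
    intro l hl
    have h1 := le_fenchel_toReal hbot hl y
    rw [← hsy] at h1
    rw [real_inner_comm]
    exact_mod_cast h1
  -- the minimiser
  set φ : EuclideanSpace ℝ (Fin d) → EReal := fun l =>
    Λ l + ((ε / 2 * ‖l‖ ^ 2 - inner ℝ y l : ℝ) : EReal) with hφ
  have hφlsc : LowerSemicontinuous φ := by
    refine hlsc.add' (Continuous.lowerSemicontinuous ?_) fun l =>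
      EReal.continuousAt_add (Or.inr (EReal.coe_ne_bot _)) (Or.inl (hbot l))
    exact continuous_coe_real_ereal.comp (by fun_prop)
  have hφreal : ∀ l ∈ effDomain Λ,
      φ l = ((f l + (ε / 2 * ‖l‖ ^ 2 - inner ℝ y l) : ℝ) : EReal) := by
    intro l hl
    rw [EReal.coe_add, hreal l hl]
  -- Outside this ball `φ m ≥ ε/2 ‖m‖² - s ≥ 0 = φ 0`, so a minimiser over the ball is global.
  set R := 2 * s / ε + 1 with hR
  have hR1 : 1 ≤ R := by rw [hR]; linarith [show 0 ≤ 2 * s / ε by positivity]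
  have h0D : (0 : EuclideanSpace ℝ (Fin d)) ∈ effDomain Λ := interior_subset hint
  have hf0 : f 0 = 0 := by simp [hf, h0]
  obtain ⟨l, hlR, hlmin⟩ := (hφlsc.lowerSemicontinuousOn _).exists_isMinOn
    (s := Metric.closedBall (0 : EuclideanSpace ℝ (Fin d)) R) ⟨0, by simp; linarith⟩
    (isCompact_closedBall _ _)
  have hl0 : φ l ≤ 0 := by
    have h1 : φ l ≤ φ 0 := hlmin (by simp; linarith)
    rwa [hφreal 0 h0D, hf0, show (0 + (ε / 2 * ‖(0 : EuclideanSpace ℝ (Fin d))‖ ^ 2 -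
      inner ℝ y 0) : ℝ) = 0 by simp, EReal.coe_zero] at h1
  have hlD : l ∈ effDomain Λ := by
    by_contra hl
    have htop : Λ l = ⊤ := by
      by_contra hne
      exact hl (lt_top_iff_ne_top.2 hne)
    rw [hφ] at hl0
    simp only [htop, EReal.top_add_coe] at hl0
    exact absurd hl0 (by simp)
  have hmin : ∀ m ∈ effDomain Λ, f l + (ε / 2 * ‖l‖ ^ 2 - inner ℝ y l) ≤
      f m + (ε / 2 * ‖m‖ ^ 2 - inner ℝ y m) := by
    intro m hm
    by_cases hmR : ‖m‖ ≤ R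
    · have h1 : φ l ≤ φ m := hlmin (by simpa using hmR)
      rw [hφreal l hlD, hφreal m hm] at h1
      exact_mod_cast h1
    · rw [hφreal l hlD] at hl0
      have h1 : f l + (ε / 2 * ‖l‖ ^ 2 - inner ℝ y l) ≤ 0 := by exact_mod_cast hl0
      have h2 := hfs m hm
      have h3 : R ≤ ‖m‖ ^ 2 := by nlinarith
      have h4 : s ≤ ε / 2 * R := by
        rw [hR]
        field_simp
        linarith
      have h5 : ε / 2 * R ≤ ε / 2 * ‖m‖ ^ 2 := by gcongr
      linarith
  have hli := mem_interior_of_isMinOn_of_steep hfconv hint hsm.differentiable hsm.steep hε.le hlD hmin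
  have hd := hsm.differentiable l hli
  have hgrad : gradient f l = y - ε • l := by
    refine gradient_eq_of_isLocalMin_add_norm_sq hd ?_
    filter_upwards [mem_interior_iff_mem_nhds.1 hli] with m hm using hmin m hm
  -- As `z` is the gradient of `f` at `l`, the supremum defining `Λ*(z)` is attained at `l`.
  set z := y - ε • l with hz
  have hzle : fenchel Λ z ≤ ((inner ℝ l z - f l : ℝ) : EReal) := by
    refine fenchel_le_of_forall hbot fun m hm => ?_
    have h1 := add_inner_gradient_le hfconv hlD hm hd
    rw [hgrad, real_inner_comm, inner_sub_left] at h1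
    change inner ℝ m z - f m ≤ _
    linarith
  have hzeq : fenchel Λ z = ((inner ℝ l z - f l : ℝ) : EReal) :=
    le_antisymm hzle (le_fenchel_toReal hbot hlD z)
  have hlz : inner ℝ l z = inner ℝ y l - ε * ‖l‖ ^ 2 := by
    rw [hz, inner_sub_right, real_inner_smul_right, real_inner_self_eq_norm_sq, real_inner_comm]
  refine ⟨z, ⟨l, hli, fun x hx => ?_⟩, ?_, ?_⟩
  · rw [hzeq, ← EReal.coe_sub, sub_sub_cancel]
    -- If `l` also attained the supremum for `x`, the first-order condition would give `x = ∇f(l) =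
    -- z`.
    have hlt : ((inner ℝ l x - f l : ℝ) : EReal) < fenchel Λ x := by
      by_contra! hle
      refine hx (Eq.symm ?_)
      rw [← hgrad]
      refine gradient_eq_of_isLocalMin_sub_inner hd ?_
      filter_upwards [mem_interior_iff_mem_nhds.1 hli] with m hm
      have h1 := (le_fenchel_toReal hbot hm x).trans hle
      have h2 : inner ℝ m x - f m ≤ inner ℝ l x - f l := by exact_mod_cast h1
      rw [real_inner_comm, real_inner_comm m x]
      linarith
    rw [EReal.sub_lt_iff (by simp) (by simp)]
    rw [EReal.coe_sub, EReal.sub_lt_iff (by simp) (by simp)] at hlt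
    rwa [add_comm]
  · rw [hzeq, ← hsy, EReal.coe_le_coe_iff, hlz]
    linarith [hfs l hlD, show 0 ≤ ε * ‖l‖ ^ 2 by positivity]
  -- The inequalities `0 ≤ Λ*(z) ≤ s - ε ‖l‖²` give `ε ‖l‖² ≤ s`, while `‖z - y‖² = ε · ε ‖l‖²`.
  · have h1 : 0 ≤ inner ℝ l z - f l := by
      have := fenchel_nonneg h0 z
      rw [hzeq] at this
      exact_mod_cast this
    have h2 : ‖z - y‖ ^ 2 = ε * (ε * ‖l‖ ^ 2) := by
      rw [hz, sub_sub_cancel_left, norm_neg, norm_smul, Real.norm_of_nonneg hε.le]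
      ring
    rw [h2]
    gcongr
    linarith [hfs l hlD]

lemma iInf_inter_exposedPoints_le (hconv : IsEConvex Λ) (h0 : Λ 0 = 0)
    (hint : (0 : EuclideanSpace ℝ (Fin d)) ∈ interior (effDomain Λ))
    (hsm : EssentiallySmooth Λ) (hlsc : LowerSemicontinuous Λ)
    {G : Set (EuclideanSpace ℝ (Fin d))} (hG : IsOpen G) :
    ⨅ x ∈ G ∩ exposedPoints Λ, fenchel Λ x ≤ ⨅ x ∈ G, fenchel Λ x := by
  refine le_iInf₂ fun y hy => ?_
  by_cases htop : fenchel Λ y = ⊤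
  · rw [htop]
    exact le_top
  obtain ⟨δ, hδ, hball⟩ := Metric.isOpen_iff.1 hG y hy
  set s := (fenchel Λ y).toReal with hs
  have hs0 : 0 ≤ s := EReal.toReal_nonneg (fenchel_nonneg h0 y)
  obtain ⟨z, hz, hzy, hdist⟩ := exists_mem_exposedPoints_norm_sub_sq_le hconv h0 hint hsm hlsc htop
    (ε := δ ^ 2 / (s + 1)) (by positivity)
  refine (iInf₂_le z ⟨hball ?_, hz⟩).trans hzy
  rw [mem_ball_iff_norm]
  refine lt_of_pow_lt_pow_left₀ 2 hδ.le (hdist.trans_lt ?_)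
  rw [div_mul_eq_mul_div, div_lt_iff₀ (by positivity)]
  nlinarith [pow_pos hδ 2]

lemma satisfiesLDP_of_tendsto {ν : ℕ → Measure (EuclideanSpace ℝ (Fin d))}
    (hconv : IsEConvex Λ) (h0 : Λ 0 = 0)
    (hint : (0 : EuclideanSpace ℝ (Fin d)) ∈ interior (effDomain Λ))
    (hlim : ∀ l ∈ interior (effDomain Λ),
      Tendsto (fun n : ℕ => logMGF (ν n) n l) atTop (𝓝 (Λ l)))
    (hsm : EssentiallySmooth Λ) (hlsc : LowerSemicontinuous Λ) :
    SatisfiesLDP ν (fenchel Λ) := by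
  intro Γ _
  have hmono : ∀ A B : Set (EuclideanSpace ℝ (Fin d)), A ⊆ B → ∀ n : ℕ,
      ENNReal.log (ν n A) / (n : EReal) ≤ ENNReal.log (ν n B) / (n : EReal) := fun A B h n =>
    EReal.div_le_div_right_of_nonneg (by positivity) (ENNReal.log_monotone (measure_mono h))
  constructor
  · refine (EReal.neg_le_neg_iff.2 (iInf_inter_exposedPoints_le hconv h0 hint hsm hlsc
      isOpen_interior)).trans ((le_liminf_of_isOpen hconv h0 hint hlim isOpen_interior).trans ?_)
    exact liminf_le_liminf (Eventually.of_forall (hmono _ _ interior_subset))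
  · refine le_trans ?_ (limsup_le_of_isClosed hconv h0 hint hlim isClosed_closure)
    exact limsup_le_limsup (Eventually.of_forall (hmono _ _ subset_closure))

end Duality

/-! ### Strong mixing: elementary properties -/

section Mixing

variable {Ω E : Type*} {𝒰 𝒰' 𝒱 𝒱' : MeasurableSpace Ω} [MeasurableSpace Ω]
  [mE : MeasurableSpace E] {P : Measure Ω}

lemma abs_mul_sub_measureReal_inter_le_one (P : Measure Ω) [IsProbabilityMeasure P] (U V : Set Ω) :
    |P.real U * P.real V - P.real (U ∩ V)| ≤ 1 := by
  have h1 : P.real U * P.real V ≤ 1 := mul_le_one₀ measureReal_le_one measureReal_nonneg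
    measureReal_le_one
  have h2 : 0 ≤ P.real U * P.real V := by positivity
  have h3 : P.real (U ∩ V) ≤ 1 := measureReal_le_one
  have h4 : 0 ≤ P.real (U ∩ V) := measureReal_nonneg
  exact abs_le.2 ⟨by linarith, by linarith⟩

variable [IsProbabilityMeasure P]

lemma bddAbove_alphaCoeff_set :
    BddAbove {r : ℝ | ∃ U V : Set Ω, MeasurableSet[𝒰] U ∧ MeasurableSet[𝒱] V ∧
      r = |P.real U * P.real V - P.real (U ∩ V)|} :=
  ⟨1, by rintro r ⟨U, V, -, -, rfl⟩; exact abs_mul_sub_measureReal_inter_le_one P U V⟩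

lemma abs_le_alphaCoeff {U V : Set Ω} (hU : MeasurableSet[𝒰] U)
    (hV : MeasurableSet[𝒱] V) :
    |P.real U * P.real V - P.real (U ∩ V)| ≤ alphaCoeff P 𝒰 𝒱 :=
  le_csSup bddAbove_alphaCoeff_set ⟨U, V, hU, hV, rfl⟩

lemma alphaCoeff_le_one : alphaCoeff P 𝒰 𝒱 ≤ 1 := by
  refine csSup_le ⟨_, ∅, ∅, @MeasurableSet.empty _ 𝒰, @MeasurableSet.empty _ 𝒱, rfl⟩ ?_
  rintro r ⟨U, V, -, -, rfl⟩
  exact abs_mul_sub_measureReal_inter_le_one P U V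

lemma alphaCoeff_nonneg : 0 ≤ alphaCoeff P 𝒰 𝒱 :=
  (abs_nonneg _).trans (abs_le_alphaCoeff (@MeasurableSet.empty _ 𝒰) (@MeasurableSet.empty _ 𝒱))

lemma alphaCoeff_mono (hU : 𝒰 ≤ 𝒰') (hV : 𝒱 ≤ 𝒱') :
    alphaCoeff P 𝒰 𝒱 ≤ alphaCoeff P 𝒰' 𝒱' := by
  refine csSup_le ⟨_, ∅, ∅, @MeasurableSet.empty _ 𝒰, @MeasurableSet.empty _ 𝒱, rfl⟩ ?_
  rintro r ⟨U, V, h1, h2, rfl⟩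
  exact abs_le_alphaCoeff (hU _ h1) (hV _ h2)

lemma bddAbove_alphaCoeff (X : ℕ → Ω → E) (m : ℕ) :
    BddAbove (Set.range fun i : ℕ => alphaCoeff P (⨆ k ∈ Set.Iic i, mE.comap (X k))
      (⨆ j ∈ Set.Ici (i + m), mE.comap (X j))) :=
  ⟨1, by rintro _ ⟨i, rfl⟩; exact alphaCoeff_le_one⟩

lemma alphaCoeff_le_mixingCoeff (X : ℕ → Ω → E) {m : ℕ} (hm : m ≠ 0) (i : ℕ) :
    alphaCoeff P (⨆ k ∈ Set.Iic i, mE.comap (X k)) (⨆ j ∈ Set.Ici (i + m), mE.comap (X j)) ≤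
      mixingCoeff P X m := by
  rw [mixingCoeff, if_neg hm]
  exact le_ciSup (bddAbove_alphaCoeff X m) i

lemma mixingCoeff_nonneg (X : ℕ → Ω → E) (m : ℕ) : 0 ≤ mixingCoeff P X m := by
  rcases eq_or_ne m 0 with rfl | hm
  · simp [mixingCoeff]
  · exact alphaCoeff_nonneg.trans (alphaCoeff_le_mixingCoeff X hm 0)

lemma mixingCoeff_le_one (X : ℕ → Ω → E) (m : ℕ) : mixingCoeff P X m ≤ 1 := by
  rw [mixingCoeff]
  split_ifs
  · norm_num
  · exact ciSup_le fun i => alphaCoeff_le_one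

lemma mixingCoeff_anti (X : ℕ → Ω → E) {m m' : ℕ} (hm : m ≠ 0) (hmm : m ≤ m') :
    mixingCoeff P X m' ≤ mixingCoeff P X m := by
  rw [mixingCoeff, if_neg (by omega)]
  refine ciSup_le fun i => le_trans (alphaCoeff_mono le_rfl ?_) (alphaCoeff_le_mixingCoeff X hm i)
  refine iSup₂_mono' fun j hj => ⟨j, ?_, le_rfl⟩
  simp only [Set.mem_Ici] at hj ⊢
  omega

/-- Integrability of powers of the inverse means polynomial decay of the mixing coefficients. -/
lemma exists_mixingCoeff_le (X : ℕ → Ω → E)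
    (hmix : ∀ h : ℝ, 0 < h → ∫⁻ u in Set.Icc (0 : ℝ) 1, (mixingInv P X u) ^ h < ⊤)
    {h : ℝ} (hh : 0 < h) :
    ∃ C : ℝ, 0 ≤ C ∧ ∀ m : ℕ, m ≠ 0 → mixingCoeff P X m ≤ C * (m : ℝ) ^ (-h) := by
  set I := ∫⁻ u in Set.Icc (0 : ℝ) 1, (mixingInv P X u) ^ h with hI
  refine ⟨2 * I.toReal, by positivity, fun m hm => ?_⟩
  set a := mixingCoeff P X m with ha
  have ha0 : 0 ≤ a := mixingCoeff_nonneg X m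
  have ha1 : a ≤ 1 := mixingCoeff_le_one X m
  -- Halving `a` keeps `u` below `1/2`, the conventional coefficient at `0`, so the infimum defining
  -- the inverse cannot be reached at `m' = 0`, where monotonicity is not available.
  have hsub : Set.Ico (0 : ℝ) (a / 2) ⊆ Set.Icc 0 1 := fun u hu =>
    ⟨hu.1, by linarith [hu.2]⟩
  have hinv : ∀ u ∈ Set.Ico (0 : ℝ) (a / 2), (m : ℝ≥0∞) ≤ mixingInv P X u := by
    intro u hu
    refine le_iInf₂ fun m' hm' => ?_
    by_contra! hlt
    have hlt' : m' < m := by exact_mod_cast hlt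
    rcases eq_or_ne m' 0 with rfl | h0
    · simp only [mixingCoeff, if_true] at hm'
      linarith [hu.2]
    · have := mixingCoeff_anti (P := P) X h0 hlt'.le
      linarith [hu.2]
  have h1 : (m : ℝ≥0∞) ^ h * ENNReal.ofReal (a / 2) ≤ I := by
    calc (m : ℝ≥0∞) ^ h * ENNReal.ofReal (a / 2)
        = ∫⁻ _ in Set.Ico (0 : ℝ) (a / 2), (m : ℝ≥0∞) ^ h := by
          rw [setLIntegral_const, Real.volume_Ico, sub_zero]
      _ ≤ ∫⁻ u in Set.Ico (0 : ℝ) (a / 2), (mixingInv P X u) ^ h := by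
          refine setLIntegral_mono' measurableSet_Ico fun u hu => ?_
          exact ENNReal.rpow_le_rpow (hinv u hu) hh.le
      _ ≤ I := lintegral_mono_set hsub
  have h2 := ENNReal.toReal_mono (hmix h hh).ne h1
  rw [ENNReal.toReal_mul, ENNReal.toReal_ofReal (by positivity), ← ENNReal.toReal_rpow,
    ENNReal.toReal_natCast] at h2
  have hmpos : (0 : ℝ) < (m : ℝ) ^ h := Real.rpow_pos_of_pos (by positivity) h
  rw [Real.rpow_neg (by positivity), ← div_eq_mul_inv, le_div_iff₀ hmpos]
  linarith

end Mixing

/-! ### Covariances of bounded variables -/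

section Covariance

variable {Ω : Type*} {𝒰 𝒱 : MeasurableSpace Ω} [MeasurableSpace Ω] {P : Measure Ω}

/-- Layer-cake formula: the additive error is integrated only over levels in `(0, M)`. Used twice,
once in each variable, it passes from covariances of events to covariances of functions. -/
lemma lintegral_le_of_measure_superlevel_le {ν : Measure Ω} {g : Ω → ℝ} (hg : Measurable g)
    (hg0 : ∀ ω, 0 ≤ g ω) {M : ℝ} (hgM : ∀ ω, g ω ≤ M) {c b : ℝ≥0∞}
    (h : ∀ t : ℝ, 0 < t → ν {ω | t < g ω} ≤ c * P {ω | t < g ω} + b) :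
    ∫⁻ ω, ENNReal.ofReal (g ω) ∂ν ≤
      c * ∫⁻ ω, ENNReal.ofReal (g ω) ∂P + b * ENNReal.ofReal M := by
  rw [lintegral_eq_lintegral_meas_lt ν (Eventually.of_forall hg0) hg.aemeasurable,
    lintegral_eq_lintegral_meas_lt P (Eventually.of_forall hg0) hg.aemeasurable]
  have hanti : Antitone fun t : ℝ => P {ω | t < g ω} := fun s t hst =>
    measure_mono fun ω (hω : t < g ω) => hst.trans_lt hω
  have hmeas : Measurable fun t : ℝ => P {ω | t < g ω} := hanti.measurable
  calc ∫⁻ t in Set.Ioi (0 : ℝ), ν {ω | t < g ω}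
      ≤ ∫⁻ t in Set.Ioi (0 : ℝ), (c * P {ω | t < g ω} +
          (Set.Iio M).indicator (fun _ => b) t) := by
        refine setLIntegral_mono' measurableSet_Ioi fun t ht => ?_
        by_cases htM : t < M
        · rw [Set.indicator_of_mem (show t ∈ Set.Iio M from htM)]
          exact h t ht
        · have : {ω | t < g ω} = ∅ := by
            ext ω
            simp only [Set.mem_ofPred_eq, Set.mem_empty_iff_false, iff_false]
            exact fun hlt => htM (hlt.trans_le (hgM ω))
          simp [this]
    _ = c * (∫⁻ t in Set.Ioi (0 : ℝ), P {ω | t < g ω}) + b * ENNReal.ofReal M := by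
        rw [lintegral_add_left (hmeas.const_mul c), lintegral_const_mul c hmeas,
          lintegral_indicator measurableSet_Iio, setLIntegral_const,
          Measure.restrict_apply measurableSet_Iio, Set.inter_comm, Set.Ioi_inter_Iio,
          Real.volume_Ioo, sub_zero]

/-- The covariance inequality for bounded nonnegative variables. -/
lemma integral_mul_le_of_measure_inter_le [IsProbabilityMeasure P]
    {a : ℝ} (ha : 0 ≤ a)
    (h : ∀ U V : Set Ω, MeasurableSet[𝒰] U → MeasurableSet[𝒱] V →
      P.real (U ∩ V) ≤ P.real U * P.real V + a)
    {f g : Ω → ℝ} (hf : Measurable f) (hg : Measurable g) (hf𝒰 : Measurable[𝒰] f)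
    (hg𝒱 : Measurable[𝒱] g) {M : ℝ} (hf0 : ∀ ω, 0 ≤ f ω) (hfM : ∀ ω, f ω ≤ M)
    (hg0 : ∀ ω, 0 ≤ g ω) (hgM : ∀ ω, g ω ≤ M) :
    ∫ ω, f ω * g ω ∂P ≤ (∫ ω, f ω ∂P) * (∫ ω, g ω ∂P) + M ^ 2 * a := by
  have hM : 0 ≤ M := by
    obtain ⟨ω⟩ := nonempty_of_isProbabilityMeasure P
    exact (hf0 ω).trans (hfM ω)
  have h1 : ∀ t s : ℝ, P ({ω | t < f ω} ∩ {ω | s < g ω}) ≤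
      P {ω | s < g ω} * P {ω | t < f ω} + ENNReal.ofReal a := by
    intro t s
    have h2 := ENNReal.ofReal_le_ofReal (h {ω | t < f ω} {ω | s < g ω}
      (hf𝒰 measurableSet_Ioi) (hg𝒱 measurableSet_Ioi))
    rwa [ENNReal.ofReal_add (by positivity) ha, ENNReal.ofReal_mul (by positivity),
      ofReal_measureReal, ofReal_measureReal, ofReal_measureReal, mul_comm (P _)] at h2
  have h2 : ∀ s : ℝ, ∫⁻ ω in {ω | s < g ω}, ENNReal.ofReal (f ω) ∂P ≤
      P {ω | s < g ω} * ∫⁻ ω, ENNReal.ofReal (f ω) ∂P + ENNReal.ofReal a * ENNReal.ofReal M := by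
    intro s
    refine lintegral_le_of_measure_superlevel_le hf hf0 hfM fun t _ => ?_
    rw [Measure.restrict_apply (measurableSet_lt measurable_const hf)]
    exact h1 t s
  have h3 : ∫⁻ ω, ENNReal.ofReal (g ω) ∂(P.withDensity fun ω => ENNReal.ofReal (f ω)) ≤
      (∫⁻ ω, ENNReal.ofReal (f ω) ∂P) * ∫⁻ ω, ENNReal.ofReal (g ω) ∂P +
        ENNReal.ofReal a * ENNReal.ofReal M * ENNReal.ofReal M := by
    refine lintegral_le_of_measure_superlevel_le hg hg0 hgM fun s _ => ?_
    rw [withDensity_apply _ (measurableSet_lt measurable_const hg), mul_comm]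
    exact h2 s
  rw [lintegral_withDensity_eq_lintegral_mul _ (by fun_prop) (by fun_prop)] at h3
  have hfi : Integrable f P := Integrable.of_bound hf.aestronglyMeasurable M
    (Eventually.of_forall fun ω => by rw [Real.norm_of_nonneg (hf0 ω)]; exact hfM ω)
  have hgi : Integrable g P := Integrable.of_bound hg.aestronglyMeasurable M
    (Eventually.of_forall fun ω => by rw [Real.norm_of_nonneg (hg0 ω)]; exact hgM ω)
  have hfgi : Integrable (fun ω => f ω * g ω) P :=
    hfi.mul_bdd hg.aestronglyMeasurable (c := M)
    (Eventually.of_forall fun ω => by rw [Real.norm_of_nonneg (hg0 ω)]; exact hgM ω)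
  have h4 : ENNReal.ofReal (∫ ω, f ω * g ω ∂P) ≤
      ENNReal.ofReal ((∫ ω, f ω ∂P) * (∫ ω, g ω ∂P) + M ^ 2 * a) := by
    have hfn : 0 ≤ ∫ ω, f ω ∂P := integral_nonneg hf0
    have hgn : 0 ≤ ∫ ω, g ω ∂P := integral_nonneg hg0
    rw [ofReal_integral_eq_lintegral_ofReal hfgi
        (Eventually.of_forall fun ω => mul_nonneg (hf0 ω) (hg0 ω)),
      ENNReal.ofReal_add (by positivity) (by positivity), ENNReal.ofReal_mul hfn,
      ofReal_integral_eq_lintegral_ofReal hfi (Eventually.of_forall hf0),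
      ofReal_integral_eq_lintegral_ofReal hgi (Eventually.of_forall hg0),
      ENNReal.ofReal_mul (by positivity), pow_two, ENNReal.ofReal_mul hM]
    calc ∫⁻ ω, ENNReal.ofReal (f ω * g ω) ∂P
        = ∫⁻ ω, ((fun ω => ENNReal.ofReal (f ω)) * fun ω => ENNReal.ofReal (g ω)) ω ∂P :=
          lintegral_congr fun ω => by rw [Pi.mul_apply, ENNReal.ofReal_mul (hf0 ω)]
      _ ≤ _ := h3
      _ = _ := by ring
  have hfn : 0 ≤ ∫ ω, f ω ∂P := integral_nonneg hf0
  have hgn : 0 ≤ ∫ ω, g ω ∂P := integral_nonneg hg0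
  exact (ENNReal.ofReal_le_ofReal_iff (by positivity)).1 h4

/-- A lower tail bound for sums of bounded variables of equal mean that are almost uncorrelated
over gaps larger than `L`. -/
lemma measure_sum_le_half_le [IsProbabilityMeasure P] {W : ℕ → Ω → ℝ} (hW : ∀ j, Measurable (W j))
    {M w b : ℝ} (hW0 : ∀ j ω, 0 ≤ W j ω) (hWM : ∀ j ω, W j ω ≤ M) (hw : 0 < w)
    (hmean : ∀ j, ∫ ω, W j ω ∂P = w) (hb : 0 ≤ b) {L : ℕ}
    (hcov : ∀ i j, i + L < j → ∫ ω, W i ω * W j ω ∂P ≤ w ^ 2 + b) {N : ℕ} (hN : 0 < N) :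
    P {ω | ∑ j ∈ Finset.range N, W j ω ≤ N * w / 2} ≤
      ENNReal.ofReal (4 * ((2 * L + 1) * M / (N * w) + b / w ^ 2)) := by
  have hM : 0 ≤ M := by
    obtain ⟨ω⟩ := nonempty_of_isProbabilityMeasure P
    exact (hW0 0 ω).trans (hWM 0 ω)
  have hN' : (0 : ℝ) < N := by exact_mod_cast hN
  have hmem : ∀ j, MemLp (W j) 2 P := fun j =>
    MemLp.of_bound (hW j).aestronglyMeasurable M
      (Eventually.of_forall fun ω => by rw [Real.norm_of_nonneg (hW0 j ω)]; exact hWM j ω)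
  have hint : ∀ j, Integrable (W j) P := fun j => (hmem j).integrable one_le_two
  have hmul : ∀ i j, Integrable (fun ω => W i ω * W j ω) P := fun i j =>
    (hmem i).integrable_mul (hmem j)
  set S : Ω → ℝ := fun ω => ∑ j ∈ Finset.range N, W j ω with hS
  have hSmem : MemLp S 2 P := memLp_finsetSum _ fun j _ => hmem j
  have hSmean : ∫ ω, S ω ∂P = N * w := by
    rw [hS, integral_finsetSum _ fun j _ => hint j]
    simp [hmean]
  have hnear : ∀ i j, ∫ ω, W i ω * W j ω ∂P ≤ M * w := by
    intro i j
    rw [← hmean j, ← integral_const_mul]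
    exact integral_mono (hmul i j) ((hint j).const_mul M) fun ω =>
      mul_le_mul_of_nonneg_right (hWM i ω) (hW0 j ω)
  -- The truncated subtraction `i - L` is harmless: indices outside the window still differ by more
  -- than `L`, and the window has at most `2L + 1` elements.
  have hpair : ∀ i j, ∫ ω, W i ω * W j ω ∂P ≤
      w ^ 2 + b + if j ∈ Finset.Icc (i - L) (i + L) then M * w else 0 := by
    intro i j
    split_ifs with hij
    · have : 0 ≤ w ^ 2 + b := by positivity
      linarith [hnear i j]
    · rw [Finset.mem_Icc, not_and_or] at hij
      rw [add_zero]
      rcases lt_or_ge (i + L) j with h | h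
      · exact hcov i j h
      · have h' : j + L < i := by omega
        simpa only [mul_comm] using hcov j i h'
  have hsq : ∫ ω, S ω ^ 2 ∂P ≤ N ^ 2 * (w ^ 2 + b) + N * ((2 * L + 1) * (M * w)) := by
    have h1 : ∀ ω, S ω ^ 2 = ∑ i ∈ Finset.range N, ∑ j ∈ Finset.range N, W i ω * W j ω := by
      intro ω
      rw [pow_two, hS, Finset.sum_mul_sum]
    simp_rw [h1]
    rw [integral_finsetSum _ fun i _ => integrable_finsetSum _ fun j _ => hmul i j]
    have h2 : ∀ i ∈ Finset.range N, ∫ ω, ∑ j ∈ Finset.range N, W i ω * W j ω ∂P ≤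
        N * (w ^ 2 + b) + (2 * L + 1) * (M * w) := by
      intro i _
      rw [integral_finsetSum _ fun j _ => hmul i j]
      refine (Finset.sum_le_sum fun j _ => hpair i j).trans ?_
      rw [Finset.sum_add_distrib, Finset.sum_const, Finset.card_range, nsmul_eq_mul,
        ← Finset.sum_filter, Finset.sum_const, nsmul_eq_mul]
      have hcard : ((Finset.range N).filter (· ∈ Finset.Icc (i - L) (i + L))).card ≤ 2 * L + 1 := by
        calc _ ≤ (Finset.Icc (i - L) (i + L)).card :=
              Finset.card_le_card fun j hj => (Finset.mem_filter.1 hj).2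
          _ ≤ 2 * L + 1 := by rw [Nat.card_Icc]; omega
      have hcard' : (((Finset.range N).filter (· ∈ Finset.Icc (i - L) (i + L))).card : ℝ) ≤
          2 * L + 1 := by exact_mod_cast hcard
      gcongr
    refine (Finset.sum_le_sum h2).trans (le_of_eq ?_)
    rw [Finset.sum_const, Finset.card_range, nsmul_eq_mul]
    ring
  have hvar : Var[S; P] ≤ N ^ 2 * b + N * ((2 * L + 1) * (M * w)) := by
    rw [variance_eq_sub hSmem, hSmean]
    have h1 : ∫ ω, (S ^ 2) ω ∂P = ∫ ω, S ω ^ 2 ∂P := rfl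
    rw [h1]
    linarith [hsq]
  have hcheb := meas_ge_le_variance_div_sq hSmem (show 0 < N * w / 2 by positivity)
  refine le_trans (measure_mono ?_) (hcheb.trans (ENNReal.ofReal_le_ofReal ?_))
  · intro ω hω
    have hω' : S ω ≤ N * w / 2 := hω
    simp only [Set.mem_ofPred_eq, hSmean]
    rw [abs_sub_comm]
    exact le_trans (by linarith) (le_abs_self _)
  · calc Var[S; P] / (N * w / 2) ^ 2
        ≤ (N ^ 2 * b + N * ((2 * L + 1) * (M * w))) / (N * w / 2) ^ 2 := by gcongr
      _ = _ := by field_simp; ring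

end Covariance

/-! ### Borel-Cantelli at an exponential rate -/

lemma ae_eventually_notMem_of_measure_le_exp {Ω : Type*} [MeasurableSpace Ω] {P : Measure Ω}
    [IsProbabilityMeasure P] {s : ℕ → Set Ω} {C θ : ℝ} (hθ : 0 < θ)
    (h : ∀ᶠ n : ℕ in atTop, P (s n) ≤ ENNReal.ofReal (C * Real.exp (n * -θ))) :
    ∀ᵐ ω ∂P, ∀ᶠ n in atTop, ω ∉ s n := by
  refine ae_eventually_notMem ?_
  have hgeom : Summable fun n : ℕ => |C| * Real.exp (n * -θ) :=
    (Real.summable_exp_nat_mul_iff.2 (by linarith)).mul_left _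
  have hsum : Summable fun n => P.real (s n) := by
    refine Summable.of_norm_bounded_eventually_nat hgeom ?_
    filter_upwards [h] with n hn
    rw [Real.norm_of_nonneg measureReal_nonneg]
    refine ENNReal.toReal_le_of_le_ofReal (by positivity) (hn.trans (ENNReal.ofReal_le_ofReal ?_))
    gcongr
    exact le_abs_self C
  have h2 := hsum.tsum_ofReal_ne_top
  simp only [ofReal_measureReal, ne_eq, measure_ne_top, not_false_eq_true] at h2
  exact h2

/-! ### Stationary sequences and blocks -/

section Blocks

variable {Ω E : Type*}

lemma shift_iterate_apply (m : ℕ) (x : ℕ → E) (i : ℕ) : shift^[m] x i = x (i + m) := by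
  induction m generalizing x with
  | zero => rfl
  | succ m ih =>
    rw [Function.iterate_succ_apply, ih]
    simp [shift, add_assoc]

/-- The sequence `z` with all coordinates from `N` on replaced by `e`. -/
def truncSeq (e : E) (N : ℕ) (z : ℕ → E) : ℕ → E := fun i => if i < N then z i else e

lemma DependsOnFirst.truncSeq {Y : Type*} {g : (ℕ → E) → Y} {N : ℕ} (hg : DependsOnFirst g N)
    (e : E) (z : ℕ → E) : g (truncSeq e N z) = g z :=
  hg _ _ fun i hi => by simp [LocalFluctuations.truncSeq, hi]

variable [mE : MeasurableSpace E] {X : ℕ → Ω → E}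

lemma measurable_shift : Measurable (shift : (ℕ → E) → ℕ → E) :=
  measurable_pi_iff.2 fun i => measurable_pi_apply (i + 1)

lemma measurable_truncSeq (e : E) (N : ℕ) : Measurable (truncSeq e N) := by
  refine measurable_pi_iff.2 fun i => ?_
  by_cases h : i < N
  · simpa only [truncSeq, h, if_true] using measurable_pi_apply i
  · simpa only [truncSeq, h, if_false] using measurable_const

lemma measurable_truncSeq_shift_iterate {𝒰 : MeasurableSpace Ω} (e : E) (m N : ℕ)
    (h𝒰 : ∀ k, m ≤ k → k < m + N → mE.comap (X k) ≤ 𝒰) :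
    Measurable[𝒰] fun ω => truncSeq e N (shift^[m] fun i => X i ω) := by
  refine measurable_pi_iff.2 fun i => ?_
  by_cases h : i < N
  · simp only [truncSeq, h, if_true, shift_iterate_apply]
    exact Measurable.of_comap_le (h𝒰 _ (by omega) (by omega))
  · simp only [truncSeq, h, if_false]
    exact measurable_const

variable [MeasurableSpace Ω] {P : Measure Ω}

lemma lintegral_shift_iterate (hX : ∀ i, Measurable (X i)) (hstat : IsStationary P X) (m : ℕ)
    {F : (ℕ → E) → ℝ≥0∞} (hF : Measurable F) :
    ∫⁻ ω, F (shift^[m] fun i => X i ω) ∂P = ∫⁻ ω, F (fun i => X i ω) ∂P := by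
  have hx : Measurable fun ω i => X i ω := measurable_pi_iff.2 hX
  have hmp : MeasurePreserving shift (P.map fun ω i => X i ω) (P.map fun ω i => X i ω) := by
    refine ⟨measurable_shift, ?_⟩
    rw [Measure.map_map measurable_shift hx]
    exact hstat
  rw [← lintegral_map (μ := P) hF hx, ← (hmp.iterate m).lintegral_comp hF]
  exact (lintegral_map (hF.comp (measurable_shift.iterate m)) hx).symm

variable [IsProbabilityMeasure P]

/-- Concentration of sums of bounded functions of the blocks of a strongly mixing stationary
sequence. -/
lemma measure_blockSum_le_half_le (hX : ∀ i, Measurable (X i)) (hstat : IsStationary P X)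
    {v : (ℕ → E) → ℝ} (hv : Measurable v) {M : ℝ} (hv0 : ∀ z, 0 ≤ v z) (hvM : ∀ z, v z ≤ M)
    (e : E) {n : ℕ} (hn : 1 ≤ n) (L : ℕ) {w : ℝ} (hw : 0 < w)
    (hmean : ∫ ω, v (truncSeq e (2 * n) fun i => X i ω) ∂P = w) {N : ℕ} (hN : 0 < N) :
    P {ω | ∑ j ∈ Finset.range N, v (truncSeq e (2 * n) (shift^[j * n] fun i => X i ω)) ≤
        N * w / 2} ≤
      ENNReal.ofReal (4 * ((2 * (L + 1 : ℕ) + 1) * M / (N * w) +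
        M ^ 2 * mixingCoeff P X (L * n + 1) / w ^ 2)) := by
  have hx : Measurable fun ω i => X i ω := measurable_pi_iff.2 hX
  have hvt : Measurable fun z : ℕ → E => v (truncSeq e (2 * n) z) :=
    hv.comp (measurable_truncSeq e (2 * n))
  have hWmeas : ∀ j : ℕ, Measurable fun ω =>
      v (truncSeq e (2 * n) (shift^[j * n] fun i => X i ω)) := fun j =>
    hvt.comp ((measurable_shift.iterate (j * n)).comp hx)
  have hWmean : ∀ j : ℕ, ∫ ω, v (truncSeq e (2 * n) (shift^[j * n] fun i => X i ω)) ∂P = w := by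
    intro j
    rw [← hmean, integral_eq_lintegral_of_nonneg_ae (Eventually.of_forall fun ω => hv0 _)
      (hWmeas j).aestronglyMeasurable, integral_eq_lintegral_of_nonneg_ae
      (Eventually.of_forall fun ω => hv0 _) (hvt.comp hx).aestronglyMeasurable,
      lintegral_shift_iterate hX hstat (j * n)
        (F := fun z => ENNReal.ofReal (v (truncSeq e (2 * n) z))) hvt.ennreal_ofReal]
  refine measure_sum_le_half_le
    (W := fun j ω => v (truncSeq e (2 * n) (shift^[j * n] fun i => X i ω)))
    hWmeas (fun j ω => hv0 _) (fun j ω => hvM _) hw hWmean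
    (mul_nonneg (sq_nonneg M) (mixingCoeff_nonneg X _)) (L := L + 1) (fun i j hij => ?_) hN
  -- Block `i` uses coordinates up to `i n + 2n - 1`. Blocks have length `2n` but start `n` apart,
  -- so one extra index of separation is needed for a gap of `L n + 1`.
  have hji : i * n + (L + 2) * n ≤ j * n := by
    rw [← add_mul]
    exact Nat.mul_le_mul_right n (by omega)
  have hle : i * n + 2 * n - 1 + (L * n + 1) ≤ j * n := by
    rw [add_mul] at hji
    omega
  have hcov := integral_mul_le_of_measure_inter_le (P := P)
    (𝒰 := ⨆ k ∈ Set.Iic (i * n + 2 * n - 1), mE.comap (X k))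
    (𝒱 := ⨆ k ∈ Set.Ici (i * n + 2 * n - 1 + (L * n + 1)), mE.comap (X k))
    (mixingCoeff_nonneg (P := P) X (L * n + 1)) (fun U V hU hV => by
      have h1 := (abs_le_alphaCoeff (P := P) hU hV).trans
        (alphaCoeff_le_mixingCoeff X (Nat.succ_ne_zero (L * n)) (i * n + 2 * n - 1))
      linarith [neg_abs_le (P.real U * P.real V - P.real (U ∩ V))])
    (hWmeas i) (hWmeas j)
    (hv.comp (measurable_truncSeq_shift_iterate e (i * n) (2 * n) fun k h1 h2 =>
      le_iSup₂_of_le k (by simp only [Set.mem_Iic]; omega) le_rfl))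
    (hv.comp (measurable_truncSeq_shift_iterate e (j * n) (2 * n) fun k h1 h2 =>
      le_iSup₂_of_le k (by simp only [Set.mem_Ici]; omega) le_rfl))
    (fun ω => hv0 _) (fun ω => hvM _) (fun ω => hv0 _) (fun ω => hvM _)
  rw [hWmean i, hWmean j, ← pow_two] at hcov
  exact hcov

/-- Truncation at a high level does not affect the mean of an exponential with a moment of order
`p > 1`. -/
lemma half_le_integral_min_exp {u : Ω → ℝ} (hu : Measurable u) {A B b p : ℝ} (hp : 1 ≤ p)
    (h1 : ENNReal.ofReal A ≤ ∫⁻ ω, ENNReal.ofReal (Real.exp (u ω)) ∂P)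
    (h2 : ∫⁻ ω, ENNReal.ofReal (Real.exp (p * u ω)) ∂P ≤ ENNReal.ofReal B)
    (hAB : 2 * (Real.exp (-((p - 1) * b)) * B) ≤ A) (hB : 0 ≤ B) :
    A / 2 ≤ ∫ ω, min (Real.exp (u ω)) (Real.exp b) ∂P := by
  have hmeas : Measurable fun ω => min (Real.exp (u ω)) (Real.exp b) :=
    hu.exp.min measurable_const
  -- Where `u > b`, one has `u ≤ p u - (p - 1) b`.
  have hpt : ∀ ω, ENNReal.ofReal (Real.exp (u ω)) ≤
      ENNReal.ofReal (min (Real.exp (u ω)) (Real.exp b)) +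
        ENNReal.ofReal (Real.exp (-((p - 1) * b))) * ENNReal.ofReal (Real.exp (p * u ω)) := by
    intro ω
    rcases le_or_gt (u ω) b with h | h
    · rw [min_eq_left (Real.exp_le_exp.2 h)]
      exact le_self_add
    · rw [← ENNReal.ofReal_mul (by positivity), ← Real.exp_add]
      refine le_trans (ENNReal.ofReal_le_ofReal (Real.exp_le_exp.2 ?_)) le_add_self
      nlinarith
  have hint : Integrable (fun ω => min (Real.exp (u ω)) (Real.exp b)) P :=
    Integrable.of_bound hmeas.aestronglyMeasurable (Real.exp b) (Eventually.of_forall fun ω => by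
      rw [Real.norm_of_nonneg (by positivity)]
      exact min_le_right _ _)
  have hI : 0 ≤ ∫ ω, min (Real.exp (u ω)) (Real.exp b) ∂P :=
    integral_nonneg fun ω => by positivity
  have h3 : ENNReal.ofReal A ≤ ENNReal.ofReal (∫ ω, min (Real.exp (u ω)) (Real.exp b) ∂P +
      Real.exp (-((p - 1) * b)) * B) := by
    calc ENNReal.ofReal A ≤ ∫⁻ ω, ENNReal.ofReal (Real.exp (u ω)) ∂P := h1
      _ ≤ _ := lintegral_mono hpt
      _ = (∫⁻ ω, ENNReal.ofReal (min (Real.exp (u ω)) (Real.exp b)) ∂P) +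
          ENNReal.ofReal (Real.exp (-((p - 1) * b))) *
            ∫⁻ ω, ENNReal.ofReal (Real.exp (p * u ω)) ∂P := by
          rw [lintegral_add_left hmeas.ennreal_ofReal,
            lintegral_const_mul _ (hu.const_mul p).exp.ennreal_ofReal]
      _ ≤ _ := by
          rw [ENNReal.ofReal_add hI (by positivity), ENNReal.ofReal_mul (by positivity),
            ofReal_integral_eq_lintegral_ofReal hint (Eventually.of_forall fun ω => by positivity)]
          gcongr
  have h4 := (ENNReal.ofReal_le_ofReal_iff (by positivity)).1 h3
  linarith

end Blocks

/-! ### Convergence of the empirical generating functions at a point -/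

section Empirical

variable {E : Type*} {d : ℕ} {SΦ : ℕ → (ℕ → E) → EuclideanSpace ℝ (Fin d)} {k : ℕ → ℕ}

lemma nat_mul_inner_inv_smul {n : ℕ} (hn : 1 ≤ n) (l y : EuclideanSpace ℝ (Fin d)) :
    (n : ℝ) * inner ℝ l ((n : ℝ)⁻¹ • y) = inner ℝ l y := by
  have : (n : ℝ) ≠ 0 := by positivity
  rw [real_inner_smul_right, mul_inv_cancel_left₀ this]

lemma expMoment_empiricalLaw (x : ℕ → E) {n : ℕ} (hn : 1 ≤ n) (l : EuclideanSpace ℝ (Fin d)) :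
    expMoment (empiricalLaw SΦ k x n) n l = (k n : ℝ≥0∞)⁻¹ *
      ∑ j ∈ Finset.range (k n), ENNReal.ofReal (Real.exp (inner ℝ l (SΦ n (shift^[j * n] x)))) := by
  rw [expMoment, empiricalLaw, lintegral_smul_measure, lintegral_finsetSum_measure, smul_eq_mul]
  congr 1
  refine Finset.sum_congr rfl fun j _ => ?_
  rw [lintegral_dirac, nat_mul_inner_inv_smul hn]

/-- Uniform approximation by functions of finitely many coordinates, which can be taken to be
measurable. -/
lemma eventually_abs_inner_sub_truncSeq_le
    (happrox : ∃ g : ℕ → (ℕ → E) → EuclideanSpace ℝ (Fin d),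
      (∀ n, 1 ≤ n → DependsOnFirst (g n) (2 * n)) ∧
      Tendsto (fun n : ℕ => (⨆ z : ℕ → E, ‖SΦ n z - g n z‖ₑ) / (n : ℝ≥0∞)) atTop (𝓝 0))
    (e : E) (l : EuclideanSpace ℝ (Fin d)) {γ : ℝ} (hγ : 0 < γ) :
    ∀ᶠ n : ℕ in atTop, ∀ z : ℕ → E,
      |inner ℝ l (SΦ n z) - inner ℝ l (SΦ n (truncSeq e (2 * n) z))| ≤ n * γ := by
  obtain ⟨g, hg, hlim⟩ := happrox
  set η := γ / (2 * (‖l‖ + 1)) with hη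
  have hη0 : 0 < η := by positivity
  filter_upwards [hlim.eventually_lt_const (ENNReal.ofReal_pos.2 hη0), eventually_ge_atTop 1]
    with n h1 hn z
  have hn0 : (n : ℝ≥0∞) ≠ 0 := by exact_mod_cast (by omega : n ≠ 0)
  have h2 : ∀ z : ℕ → E, ‖SΦ n z - g n z‖ ≤ n * η := by
    intro z
    have h3 : ‖SΦ n z - g n z‖ₑ ≤ ENNReal.ofReal (n * η) := by
      refine (le_iSup (fun z : ℕ → E => ‖SΦ n z - g n z‖ₑ) z).trans ?_
      have h4 := (ENNReal.div_le_iff hn0 (ENNReal.natCast_ne_top n)).1 h1.le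
      rwa [ENNReal.ofReal_mul (by positivity), ENNReal.ofReal_natCast, mul_comm]
    rw [← ofReal_norm] at h3
    exact (ENNReal.ofReal_le_ofReal_iff (by positivity)).1 h3
  -- `g n` agrees at `z` and at its truncation, so it serves only as an intermediate point. No
  -- measurability of `g n` is known, whereas `SΦ n ∘ truncSeq e (2 * n)` is measurable when `SΦ n`
  -- is.
  have h3 : ‖SΦ n z - SΦ n (truncSeq e (2 * n) z)‖ ≤ 2 * (n * η) := by
    have h4 := h2 (truncSeq e (2 * n) z)
    rw [(hg n hn).truncSeq e z] at h4
    calc _ = ‖(SΦ n z - g n z) - (SΦ n (truncSeq e (2 * n) z) - g n z)‖ := by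
          rw [sub_sub_sub_cancel_right]
      _ ≤ _ := norm_sub_le _ _
      _ ≤ _ := by linarith [h2 z]
  rw [← inner_sub_right]
  calc _ ≤ ‖l‖ * ‖SΦ n z - SΦ n (truncSeq e (2 * n) z)‖ := abs_real_inner_le_norm _ _
    _ ≤ (‖l‖ + 1) * (2 * (n * η)) := by gcongr; linarith
    _ = n * γ := by rw [hη]; field_simp

variable {Ω : Type*} [MeasurableSpace Ω] [mE : MeasurableSpace E] {P : Measure Ω}
  {X : ℕ → Ω → E}

lemma expMoment_scaledLaw (hX : ∀ i, Measurable (X i)) {n : ℕ} (hn : 1 ≤ n)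
    (hSΦ : Measurable (SΦ n)) (l : EuclideanSpace ℝ (Fin d)) :
    expMoment (scaledLaw P X SΦ n) n l =
      ∫⁻ ω, ENNReal.ofReal (Real.exp (inner ℝ l (SΦ n fun i => X i ω))) ∂P := by
  have hx : Measurable fun ω i => X i ω := measurable_pi_iff.2 hX
  have hm : Measurable fun ω => (n : ℝ)⁻¹ • SΦ n fun i => X i ω := (hSΦ.comp hx).const_smul (n : ℝ)⁻¹
  rw [expMoment, scaledLaw, lintegral_map (by fun_prop) hm]
  simp_rw [nat_mul_inner_inv_smul hn]

variable [IsProbabilityMeasure P]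

/-- The upper bound follows from Markov's inequality. -/
lemma ae_eventually_expMoment_empiricalLaw_le (hX : ∀ i, Measurable (X i))
    (hstat : IsStationary P X) (hSΦ : ∀ n, 1 ≤ n → Measurable (SΦ n))
    (hkpos : ∀ n, 1 ≤ n → 0 < k n) {l : EuclideanSpace ℝ (Fin d)} {r : ℝ}
    (hr : Tendsto (fun n : ℕ => logMGF (scaledLaw P X SΦ n) n l) atTop (𝓝 (r : EReal)))
    {ε : ℝ} (hε : 0 < ε) :
    ∀ᵐ ω ∂P, ∀ᶠ n : ℕ in atTop, expMoment (empiricalLaw SΦ k (fun i => X i ω) n) n l ≤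
      ENNReal.ofReal (Real.exp (n * (r + ε))) := by
  have hx : Measurable fun ω i => X i ω := measurable_pi_iff.2 hX
  have hbound : ∀ᶠ n : ℕ in atTop,
      P {ω | ENNReal.ofReal (Real.exp (n * (r + ε))) <
        expMoment (empiricalLaw SΦ k (fun i => X i ω) n) n l} ≤
      ENNReal.ofReal (1 * Real.exp (n * -(ε / 2))) := by
    filter_upwards [eventually_lt_exp_of_tendsto hr (A := r + ε / 2)
      (by exact_mod_cast (by linarith : r < r + ε / 2)), eventually_ge_atTop 1] with n h1 hn
    have hF : Measurable fun z : ℕ → E => ENNReal.ofReal (Real.exp (inner ℝ l (SΦ n z))) := by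
      have := hSΦ n hn
      fun_prop
    have hFj : ∀ j : ℕ, Measurable fun ω =>
        ENNReal.ofReal (Real.exp (inner ℝ l (SΦ n (shift^[j * n] fun i => X i ω)))) := fun j =>
      hF.comp ((measurable_shift.iterate (j * n)).comp hx)
    -- By stationarity all blocks have the same exponential moment; no independence is needed for
    -- the mean.
    have hmean : ∫⁻ ω, expMoment (empiricalLaw SΦ k (fun i => X i ω) n) n l ∂P =
        expMoment (scaledLaw P X SΦ n) n l := by
      have hk0 : (k n : ℝ≥0∞) ≠ 0 := by exact_mod_cast (hkpos n hn).ne'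
      simp_rw [expMoment_empiricalLaw _ hn]
      rw [lintegral_const_mul _ (Finset.measurable_fun_sum _ fun j _ => hFj j),
        lintegral_finsetSum _ fun j _ => hFj j, expMoment_scaledLaw hX hn (hSΦ n hn)]
      simp_rw [fun j : ℕ => lintegral_shift_iterate hX hstat (j * n) hF]
      rw [Finset.sum_const, Finset.card_range, nsmul_eq_mul, ← mul_assoc,
        ENNReal.inv_mul_cancel hk0 (ENNReal.natCast_ne_top _), one_mul]
    have hmeas : Measurable fun ω => expMoment (empiricalLaw SΦ k (fun i => X i ω) n) n l := by
      simp_rw [expMoment_empiricalLaw _ hn]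
      exact (Finset.measurable_fun_sum _ fun j _ => hFj j).const_mul _
    have hmarkov := (mul_meas_ge_le_lintegral (μ := P) hmeas
      (ENNReal.ofReal (Real.exp (n * (r + ε))))).trans_eq hmean
    set s := {ω | ENNReal.ofReal (Real.exp (n * (r + ε))) <
        expMoment (empiricalLaw SΦ k (fun i => X i ω) n) n l} with hs
    have h2 : ENNReal.ofReal (Real.exp (n * (r + ε))) * P s ≤
        ENNReal.ofReal (Real.exp (n * (r + ε / 2))) := by
      refine le_trans ?_ (hmarkov.trans h1.le)
      gcongr
      intro ω hω
      rw [hs, Set.mem_ofPred_eq] at hω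
      exact hω.le
    calc P s = ENNReal.ofReal (Real.exp (n * -(r + ε))) *
          (ENNReal.ofReal (Real.exp (n * (r + ε))) * P s) := by
          rw [← mul_assoc, ← ENNReal.ofReal_mul (by positivity), ← Real.exp_add, ← mul_add,
            neg_add_cancel]
          simp
      _ ≤ ENNReal.ofReal (Real.exp (n * -(r + ε))) *
          ENNReal.ofReal (Real.exp (n * (r + ε / 2))) := by gcongr
      _ = _ := by
          rw [← ENNReal.ofReal_mul (by positivity), ← Real.exp_add, ← mul_add, one_mul]
          ring_nf
  filter_upwards [ae_eventually_notMem_of_measure_le_exp (by positivity) hbound] with ω hω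
  filter_upwards [hω] with n hn
  simpa using hn

/-- The lower bound: the number of blocks is large enough for the empirical exponential moment to
be close to its mean. -/
lemma ae_eventually_le_expMoment_empiricalLaw (hX : ∀ i, Measurable (X i))
    (hstat : IsStationary P X) (hSΦ : ∀ n, 1 ≤ n → Measurable (SΦ n))
    (hkpos : ∀ n, 1 ≤ n → 0 < k n)
    (hmix : ∀ h : ℝ, 0 < h → ∫⁻ u in Set.Icc (0 : ℝ) 1, (mixingInv P X u) ^ h < ⊤)
    (happrox : ∃ g : ℕ → (ℕ → E) → EuclideanSpace ℝ (Fin d),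
      (∀ n, 1 ≤ n → DependsOnFirst (g n) (2 * n)) ∧
      Tendsto (fun n : ℕ => (⨆ z : ℕ → E, ‖SΦ n z - g n z‖ₑ) / (n : ℝ≥0∞)) atTop (𝓝 0))
    {l : EuclideanSpace ℝ (Fin d)} {r s p κ : ℝ} (hp : 1 < p)
    (hr : Tendsto (fun n : ℕ => logMGF (scaledLaw P X SΦ n) n l) atTop (𝓝 (r : EReal)))
    (hs : Tendsto (fun n : ℕ => logMGF (scaledLaw P X SΦ n) n (p • l)) atTop (𝓝 (s : EReal)))
    (hκ : ∀ᶠ n : ℕ in atTop, Real.exp (n * κ) ≤ k n) (hgap : s - p * r < (p - 1) * κ)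
    {ε : ℝ} (hε : 0 < ε) :
    ∀ᵐ ω ∂P, ∀ᶠ n : ℕ in atTop, ENNReal.ofReal (Real.exp (n * (r - ε))) ≤
      expMoment (empiricalLaw SΦ k (fun i => X i ω) n) n l := by
  have hx : Measurable fun ω i => X i ω := measurable_pi_iff.2 hX
  obtain ⟨ω₀⟩ := nonempty_of_isProbabilityMeasure P
  set e : E := X 0 ω₀
  have hp1 : 0 < p - 1 := by linarith
  set Δ := (p - 1) * κ - (s - p * r) with hΔ
  have hΔ0 : 0 < Δ := by linarith
  -- The errors in the exponent add up to `(2 (p - 1) + 3) δ`, at most half of the available gap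
  -- `Δ`; the other half gives the rate `θ`.
  set δ := min (ε / 4) (Δ / (2 * (2 * (p - 1) + 3))) with hδ
  have hδ0 : 0 < δ := lt_min (by positivity) (by positivity)
  have hδε : δ ≤ ε / 4 := min_le_left _ _
  have hδΔ : δ * (2 * (2 * (p - 1) + 3)) ≤ Δ := by
    rw [← le_div_iff₀ (by positivity)]
    exact min_le_right _ _
  -- Truncation level: the discarded part of the mean is at most `exp(n (s + δ - (p - 1) b)) = exp(n
  -- (r - 2 δ))`, negligible against `exp(n (r - δ))`.
  set b := (s - r + 3 * δ) / (p - 1) with hb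
  have hpb : (p - 1) * b = s - r + 3 * δ := by rw [hb]; field_simp
  set θ := Δ / (2 * (p - 1)) with hθ
  have hθ0 : 0 < θ := by positivity
  have hθ' : 2 * δ + b - r - κ ≤ -θ := by
    refine le_of_mul_le_mul_left ?_ hp1
    have h1 : (p - 1) * -θ = -(Δ / 2) := by rw [hθ]; field_simp
    have h2 : (p - 1) * (2 * δ + b - r - κ) = 2 * δ * (p - 1) + 3 * δ - Δ := by
      linear_combination hpb - hΔ
    rw [h1, h2]
    linarith
  -- Order of the polynomial decay: at distance `exp(n δ)` it must beat the ratio `M² / w²`, of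
  -- order `exp(n (2b - 2r + 2δ))`, with `exp(-n θ)` to spare.
  set h := (|2 * b - 2 * r + 2 * δ| + θ) / δ with hh
  have hh0 : 0 < h := by positivity
  have hδh : δ * h = |2 * b - 2 * r + 2 * δ| + θ := by rw [hh]; field_simp
  obtain ⟨C, hC0, hC⟩ := exists_mixingCoeff_le X hmix hh0
  -- means of the truncated variables
  set v : ℕ → (ℕ → E) → ℝ := fun n z =>
    min (Real.exp (inner ℝ l (SΦ n z))) (Real.exp (n * b)) with hv
  set w : ℕ → ℝ := fun n => ∫ ω, v n (truncSeq e (2 * n) fun i => X i ω) ∂P with hw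
  -- Dividing by `p` keeps the error at most `n δ / 2` for the slope `p • l` as well.
  have hclose := eventually_abs_inner_sub_truncSeq_le happrox e l
    (show 0 < δ / (2 * p) by positivity)
  have hwlow : ∀ᶠ n : ℕ in atTop, Real.exp (n * (r - δ)) / 2 ≤ w n := by
    filter_upwards [hclose, eventually_exp_lt_of_tendsto hr (A := r - δ / 2)
        (by exact_mod_cast (by linarith : r - δ / 2 < r)),
      eventually_lt_exp_of_tendsto hs (A := s + δ / 2)
        (by exact_mod_cast (by linarith : s < s + δ / 2)), eventually_ge_atTop 1,
      eventually_const_mul_exp_le 2 (show r - 2 * δ < r - δ by linarith)] with n h1 h2 h3 hn h4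
    have hn' : (0 : ℝ) ≤ n := by positivity
    have h2' : ENNReal.ofReal (Real.exp (n * (r - δ / 2))) <
      expMoment (scaledLaw P X SΦ n) n l := h2
    have h3' : expMoment (scaledLaw P X SΦ n) n (p • l) <
      ENNReal.ofReal (Real.exp (n * (s + δ / 2))) := h3
    rw [expMoment_scaledLaw hX hn (hSΦ n hn)] at h2' h3'
    have hγp : (n : ℝ) * (δ / (2 * p)) * p = n * (δ / 2) := by field_simp
    have hγ : (n : ℝ) * (δ / (2 * p)) ≤ n * (δ / 2) := by
      gcongr
      linarith
    have hmeas : Measurable fun z : ℕ → E => inner ℝ l (SΦ n z) := by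
      have := hSΦ n hn
      fun_prop
    refine half_le_integral_min_exp (P := P) (p := p) (B := Real.exp (n * (s + δ)))
      (hmeas.comp ((measurable_truncSeq e (2 * n)).comp hx)) hp.le ?_ ?_ ?_ (by positivity)
    · calc ENNReal.ofReal (Real.exp (n * (r - δ)))
          = ENNReal.ofReal (Real.exp (-(n * (δ / 2)))) *
              ENNReal.ofReal (Real.exp (n * (r - δ / 2))) := by
            rw [← ENNReal.ofReal_mul (by positivity), ← Real.exp_add]
            ring_nf
        _ ≤ ENNReal.ofReal (Real.exp (-(n * (δ / 2)))) *
              ∫⁻ ω, ENNReal.ofReal (Real.exp (inner ℝ l (SΦ n fun i => X i ω))) ∂P := by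
            gcongr
        _ = ∫⁻ ω, ENNReal.ofReal (Real.exp (-(n * (δ / 2)))) *
              ENNReal.ofReal (Real.exp (inner ℝ l (SΦ n fun i => X i ω))) ∂P :=
            (lintegral_const_mul _ (hmeas.comp hx).exp.ennreal_ofReal).symm
        _ ≤ _ := by
            refine lintegral_mono fun ω => ?_
            rw [← ENNReal.ofReal_mul (by positivity), ← Real.exp_add]
            refine ENNReal.ofReal_le_ofReal (Real.exp_le_exp.2 ?_)
            have := (abs_le.1 (h1 fun i => X i ω)).2
            simp only [Function.comp_apply]
            linarith
    · calc ∫⁻ ω, ENNReal.ofReal (Real.exp (p * inner ℝ l (SΦ n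
              (truncSeq e (2 * n) fun i => X i ω)))) ∂P
          ≤ ∫⁻ ω, ENNReal.ofReal (Real.exp (n * (δ / 2))) *
              ENNReal.ofReal (Real.exp (inner ℝ (p • l) (SΦ n fun i => X i ω))) ∂P := by
            refine lintegral_mono fun ω => ?_
            rw [← ENNReal.ofReal_mul (by positivity), ← Real.exp_add]
            refine ENNReal.ofReal_le_ofReal (Real.exp_le_exp.2 ?_)
            have := (abs_le.1 (h1 fun i => X i ω)).1
            rw [real_inner_smul_left]
            nlinarith
        _ = ENNReal.ofReal (Real.exp (n * (δ / 2))) *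
              ∫⁻ ω, ENNReal.ofReal (Real.exp (inner ℝ (p • l) (SΦ n fun i => X i ω))) ∂P := by
            refine lintegral_const_mul _ ?_
            have := hSΦ n hn
            fun_prop
        _ ≤ ENNReal.ofReal (Real.exp (n * (δ / 2))) *
              ENNReal.ofReal (Real.exp (n * (s + δ / 2))) := by gcongr
        _ = ENNReal.ofReal (Real.exp (n * (s + δ))) := by
            rw [← ENNReal.ofReal_mul (by positivity), ← Real.exp_add]
            ring_nf
    · rw [← Real.exp_add]
      refine le_trans (le_of_eq ?_) h4
      congr 2
      linear_combination (-(n : ℝ)) * hpb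
  -- the probability that the empirical sum is small
  have hbound : ∀ᶠ n : ℕ in atTop,
      P {ω | ∑ j ∈ Finset.range (k n),
        v n (truncSeq e (2 * n) (shift^[j * n] fun i => X i ω)) ≤ k n * w n / 2} ≤
      ENNReal.ofReal ((56 + 16 * C) * Real.exp (n * -θ)) := by
    filter_upwards [hwlow, hκ, eventually_ge_atTop 1] with n h1 h2 hn
    have hn' : (0 : ℝ) ≤ n := by positivity
    have hn1 : (1 : ℝ) ≤ n := by exact_mod_cast hn
    have hvmeas : Measurable (v n) := by
      have := hSΦ n hn
      simp only [hv]
      fun_prop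
    set q := Real.exp (n * (r - δ)) with hq
    have hq0 : 0 < q := Real.exp_pos _
    have hw0 : 0 < w n := by linarith
    -- An exponentially long gap costs only a factor `exp(n δ)` in the variance, yet makes the
    -- mixing coefficient as small as needed.
    set L := ⌈Real.exp (n * δ)⌉₊ with hL
    have hexp1 : 1 ≤ Real.exp (n * δ) := Real.one_le_exp (by positivity)
    refine (measure_blockSum_le_half_le hX hstat hvmeas (M := Real.exp (n * b))
      (fun z => by simp only [hv]; positivity) (fun z => min_le_right _ _) e hn L hw0 rfl
      (hkpos n hn)).trans (ENNReal.ofReal_le_ofReal ?_)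
    have hL1 : (2 * ((L + 1 : ℕ) : ℝ) + 1) ≤ 7 * Real.exp (n * δ) := by
      have := (Nat.ceil_lt_add_one (Real.exp_pos (n * δ)).le).le
      push_cast
      linarith
    have hkn : 0 < Real.exp (n * κ) := Real.exp_pos _
    have hfirst : (2 * ((L + 1 : ℕ) : ℝ) + 1) * Real.exp (n * b) / (k n * w n) ≤
        14 * Real.exp (n * -θ) := by
      calc (2 * ((L + 1 : ℕ) : ℝ) + 1) * Real.exp (n * b) / (k n * w n)
          ≤ (7 * Real.exp (n * δ)) * Real.exp (n * b) / (Real.exp (n * κ) * (q / 2)) := by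
            gcongr
        _ = 14 * Real.exp (n * (2 * δ + b - r - κ)) := by
            rw [hq, show (n : ℝ) * (2 * δ + b - r - κ) =
              n * δ + n * b - (n * κ + n * (r - δ)) by ring, Real.exp_sub, Real.exp_add,
              Real.exp_add]
            field_simp
            norm_num
        _ ≤ _ := by gcongr
    have hα : mixingCoeff P X (L * n + 1) ≤ C * Real.exp (-(n * (δ * h))) := by
      refine (hC _ (Nat.succ_ne_zero _)).trans ?_
      gcongr
      have hLn : Real.exp (n * δ) ≤ ((L * n + 1 : ℕ) : ℝ) := by
        have := Nat.le_ceil (Real.exp (n * δ))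
        push_cast
        nlinarith [Nat.cast_nonneg (α := ℝ) L]
      refine (Real.rpow_le_rpow_of_nonpos (Real.exp_pos _) hLn (by linarith)).trans (le_of_eq ?_)
      rw [← Real.exp_mul]
      ring_nf
    have hsecond : Real.exp (n * b) ^ 2 * mixingCoeff P X (L * n + 1) / w n ^ 2 ≤
        4 * C * Real.exp (n * -θ) := by
      calc Real.exp (n * b) ^ 2 * mixingCoeff P X (L * n + 1) / w n ^ 2
          ≤ Real.exp (n * b) ^ 2 * (C * Real.exp (-(n * (δ * h)))) / (q / 2) ^ 2 := by
            gcongr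
        _ = 4 * C * Real.exp (n * (2 * b - 2 * r + 2 * δ - δ * h)) := by
            rw [hq, show (n : ℝ) * (2 * b - 2 * r + 2 * δ - δ * h) =
              n * b + n * b + -(n * (δ * h)) - (n * (r - δ) + n * (r - δ)) by ring, Real.exp_sub,
              Real.exp_add, Real.exp_add, Real.exp_add]
            field_simp
            norm_num
        _ ≤ _ := by
            gcongr
            rw [hδh]
            linarith [le_abs_self (2 * b - 2 * r + 2 * δ)]
    linarith
  filter_upwards [ae_eventually_notMem_of_measure_le_exp hθ0 hbound] with ω hω
  filter_upwards [hω, hwlow, hclose, eventually_ge_atTop 1,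
    eventually_const_mul_exp_le 4 (show r - ε < r - 2 * δ by linarith)] with n h1 h2 h3 hn h4
  simp only [not_le] at h1
  have hk0 : (0 : ℝ) < k n := by exact_mod_cast hkpos n hn
  have hn' : (0 : ℝ) ≤ n := by positivity
  have hγ : (n : ℝ) * (δ / (2 * p)) ≤ n * δ := by
    gcongr
    rw [div_le_iff₀ (by positivity)]
    nlinarith
  have h5 : (k n : ℝ) * Real.exp (n * (r - ε)) ≤
      ∑ j ∈ Finset.range (k n), Real.exp (inner ℝ l (SΦ n (shift^[j * n] fun i => X i ω))) := by
    calc (k n : ℝ) * Real.exp (n * (r - ε))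
        ≤ k n * (Real.exp (n * (r - 2 * δ)) / 4) := by
          gcongr
          linarith
      _ = Real.exp (-(n * δ)) * (k n * (Real.exp (n * (r - δ)) / 2) / 2) := by
          rw [show (n : ℝ) * (r - 2 * δ) = -(n * δ) + n * (r - δ) by ring, Real.exp_add]
          ring
      _ ≤ Real.exp (-(n * δ)) * ∑ j ∈ Finset.range (k n),
            v n (truncSeq e (2 * n) (shift^[j * n] fun i => X i ω)) := by
          gcongr
          exact le_trans (by gcongr) h1.le
      _ ≤ _ := by
          rw [Finset.mul_sum]
          refine Finset.sum_le_sum fun j _ => ?_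
          have h6 := (abs_le.1 (h3 (shift^[j * n] fun i => X i ω))).1
          calc _ ≤ Real.exp (-(n * δ)) * Real.exp (inner ℝ l
                (SΦ n (truncSeq e (2 * n) (shift^[j * n] fun i => X i ω)))) := by
                gcongr
                exact min_le_left _ _
            _ ≤ _ := by
                rw [← Real.exp_add]
                exact Real.exp_le_exp.2 (by linarith)
  rw [expMoment_empiricalLaw _ hn, ← ENNReal.ofReal_sum_of_nonneg fun j _ => by positivity]
  have hk1 : (k n : ℝ≥0∞) ≠ 0 := by exact_mod_cast (hkpos n hn).ne'
  calc ENNReal.ofReal (Real.exp (n * (r - ε)))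
      = (k n : ℝ≥0∞)⁻¹ * ENNReal.ofReal (k n * Real.exp (n * (r - ε))) := by
        rw [ENNReal.ofReal_mul hk0.le, ENNReal.ofReal_natCast, ← mul_assoc,
          ENNReal.inv_mul_cancel hk1 (ENNReal.natCast_ne_top _), one_mul]
    _ ≤ _ := by gcongr

end Empirical

/-! ### Convergence on the interior of the domain -/

section Convergence

variable {d : ℕ}

lemma isEConvex_logMGF (μ : Measure (EuclideanSpace ℝ (Fin d))) {n : ℕ} (hn : 1 ≤ n) :
    IsEConvex (logMGF μ n) := fun _ _ _ _ _ _ ha hb hab hA hB =>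
  (log_div_le_iff hn).2 (expMoment_combo_le_exp ha hb hab
    ((log_div_le_iff hn).1 hA.le) ((log_div_le_iff hn).1 hB.le))

section

variable {E : Type*} {SΦ : ℕ → (ℕ → E) → EuclideanSpace ℝ (Fin d)} {k : ℕ → ℕ} (x : ℕ → E) {n : ℕ}

lemma expMoment_empiricalLaw_ne_top (hn : 1 ≤ n) (hk : 0 < k n) (l : EuclideanSpace ℝ (Fin d)) :
    expMoment (empiricalLaw SΦ k x n) n l ≠ ⊤ := by
  have hk0 : (k n : ℝ≥0∞) ≠ 0 := by exact_mod_cast hk.ne'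
  rw [expMoment_empiricalLaw x hn]
  exact ENNReal.mul_ne_top (ENNReal.inv_ne_top.2 hk0)
    (ENNReal.sum_ne_top.2 fun j _ => ENNReal.ofReal_ne_top)

lemma expMoment_empiricalLaw_ne_zero (hn : 1 ≤ n) (hk : 0 < k n)
    (l : EuclideanSpace ℝ (Fin d)) : expMoment (empiricalLaw SΦ k x n) n l ≠ 0 := by
  rw [expMoment_empiricalLaw x hn]
  refine mul_ne_zero (ENNReal.inv_ne_zero.2 (ENNReal.natCast_ne_top _)) fun h0 => ?_
  have h1 := Finset.sum_eq_zero_iff.1 h0 0 (Finset.mem_range.2 hk)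
  exact absurd h1 (ENNReal.ofReal_pos.2 (Real.exp_pos _)).ne'

/-- A finite non-empty sum of exponentials is finite and positive, so `Λ_n^ω` is real-valued on the
whole space and `toReal` loses nothing. -/
lemma logMGF_empiricalLaw_eq_coe (hn : 1 ≤ n) (hk : 0 < k n) (l : EuclideanSpace ℝ (Fin d)) :
    logMGF (empiricalLaw SΦ k x n) n l =
      ((Real.log (expMoment (empiricalLaw SΦ k x n) n l).toReal / n : ℝ) : EReal) := by
  rw [logMGF_eq, ENNReal.log_pos_real (expMoment_empiricalLaw_ne_zero x hn hk l)
    (expMoment_empiricalLaw_ne_top x hn hk l), EReal.coe_div]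
  rfl

lemma coe_toReal_logMGF_empiricalLaw (hn : 1 ≤ n) (hk : 0 < k n)
    (l : EuclideanSpace ℝ (Fin d)) :
    ((logMGF (empiricalLaw SΦ k x n) n l).toReal : EReal) = logMGF (empiricalLaw SΦ k x n) n l := by
  rw [logMGF_empiricalLaw_eq_coe x hn hk, EReal.toReal_coe]

lemma convexOn_logMGF_empiricalLaw (hn : 1 ≤ n) (hk : 0 < k n) :
    ConvexOn ℝ Set.univ fun l => (logMGF (empiricalLaw SΦ k x n) n l).toReal := by
  have hdom : effDomain (logMGF (empiricalLaw SΦ k x n) n) = Set.univ := by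
    refine Set.eq_univ_of_forall fun l => ?_
    rw [effDomain, Set.mem_ofPred_eq, logMGF_empiricalLaw_eq_coe x hn hk]
    exact EReal.coe_lt_top _
  rw [← hdom]
  refine (isEConvex_logMGF _ hn).convexOn_toReal fun l => ?_
  rw [logMGF_empiricalLaw_eq_coe x hn hk]
  exact EReal.coe_ne_bot _

end

variable {Λ : EuclideanSpace ℝ (Fin d) → EReal}

/-- The Legendre transform of a convex function at a subgradient. -/
lemma fenchel_subgradient_le (hconv : IsEConvex Λ) (h0 : Λ 0 = 0)
    (hint : (0 : EuclideanSpace ℝ (Fin d)) ∈ interior (effDomain Λ))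
    {l x : EuclideanSpace ℝ (Fin d)}
    (hx : ∀ m ∈ interior (effDomain Λ), (Λ l).toReal + inner ℝ x (m - l) ≤ (Λ m).toReal) :
    fenchel Λ x ≤ ((inner ℝ l x - (Λ l).toReal : ℝ) : EReal) := by
  by_contra! hlt
  obtain ⟨m, hm, hmx⟩ := hconv.exists_mem_interior_lt h0 hint hlt
  have h1 := hx m hm
  rw [inner_sub_right, real_inner_comm, real_inner_comm l] at h1
  linarith

/-- The growth condition on the number of blocks, in the form needed for moments of order
slightly larger than one. -/
lemma exists_moment_gap (hconv : IsEConvex Λ) (h0 : Λ 0 = 0)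
    (hint : (0 : EuclideanSpace ℝ (Fin d)) ∈ interior (effDomain Λ)) {k : ℕ → ℕ}
    (hkpos : ∀ n, 1 ≤ n → 0 < k n)
    (hk : ((⨆ x ∈ effDomain (fenchel Λ), fenchel Λ x) < ⊤ ∧
        (⨆ x ∈ effDomain (fenchel Λ), fenchel Λ x) <
          liminf (fun n : ℕ => ((Real.log (k n) / n : ℝ) : EReal)) atTop) ∨
      Tendsto (fun n : ℕ => Real.log (k n) / n) atTop atTop)
    {l : EuclideanSpace ℝ (Fin d)} (hl : l ∈ interior (effDomain Λ)) :
    ∃ p κ : ℝ, 1 < p ∧ p • l ∈ interior (effDomain Λ) ∧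
      (∀ᶠ n : ℕ in atTop, Real.exp (n * κ) ≤ k n) ∧
      (Λ (p • l)).toReal - p * (Λ l).toReal < (p - 1) * κ := by
  have hbot := hconv.ne_bot h0 hint
  have hexp : ∀ κ : ℝ, (∀ᶠ n : ℕ in atTop, κ ≤ Real.log (k n) / n) →
      ∀ᶠ n : ℕ in atTop, Real.exp (n * κ) ≤ k n := by
    intro κ h
    filter_upwards [h, eventually_ge_atTop 1] with n h1 hn
    have hk0 : (0 : ℝ) < k n := by exact_mod_cast hkpos n hn
    have hn0 : (0 : ℝ) < n := by exact_mod_cast hn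
    rw [← Real.le_log_iff_exp_le hk0, mul_comm]
    exact (le_div_iff₀ hn0).1 h1
  have hcont : Tendsto (fun p : ℝ => p • l) (𝓝[>] 1) (𝓝 l) := by
    have : Continuous fun p : ℝ => p • l := by fun_prop
    exact (this.tendsto' 1 l (one_smul ℝ l)).mono_left nhdsWithin_le_nhds
  have hmem : ∀ᶠ p : ℝ in 𝓝[>] 1, p • l ∈ interior (effDomain Λ) :=
    hcont.eventually (isOpen_interior.mem_nhds hl)
  rcases hk with ⟨-, hlt⟩ | htop
  · obtain ⟨κ, hcκ, hκ⟩ := EReal.lt_iff_exists_real_btwn.1 hlt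
    obtain ⟨κ', hcκ', hκκ'⟩ := EReal.lt_iff_exists_real_btwn.1 hcκ
    have hκκ : κ' < κ := by exact_mod_cast hκκ'
    have hfconv : ConvexOn ℝ (interior (effDomain Λ)) fun m => (Λ m).toReal :=
      (hconv.convexOn_toReal hbot).subset interior_subset hconv.convex_effDomain.interior
    -- This function of `p` will bound `⟨l, x⟩ - Λ(l)` for a subgradient `x` at `p l`. The slack
    -- between `κ'` and `κ` makes it smaller than `κ` for `p` near `1`.
    have hf : Tendsto (fun p : ℝ => (κ' + (Λ (p • l)).toReal) / p - (Λ l).toReal) (𝓝[>] 1)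
        (𝓝 κ') := by
      have h1 : Tendsto (fun p : ℝ => (Λ (p • l)).toReal) (𝓝[>] 1) (𝓝 (Λ l).toReal) :=
        ((hfconv.continuousOn isOpen_interior).continuousAt
          (isOpen_interior.mem_nhds hl)).tendsto.comp hcont
      have h2 : Tendsto (fun p : ℝ => p) (𝓝[>] 1) (𝓝 1) := nhdsWithin_le_nhds
      simpa using ((h1.const_add κ').div h2 one_ne_zero).sub_const (Λ l).toReal
    obtain ⟨p, ⟨hpU, hpκ⟩, hp1 : 1 < p⟩ :=
      ((hmem.and (hf.eventually_lt_const hκκ)).and self_mem_nhdsWithin).exists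
    refine ⟨p, κ, hp1, hpU, hexp κ ?_, ?_⟩
    · refine (eventually_lt_of_lt_liminf hκ).mono fun n hn => ?_
      exact (EReal.coe_lt_coe_iff.1 hn).le
    -- At a subgradient, `Λ*(x) = ⟨p l, x⟩ - Λ(p l)` is finite, hence at most `sup Λ* < κ'`. The
    -- subgradient inequality tested at `l` gives `Λ(p l) - p Λ(l) ≤ (p - 1)(⟨l, x⟩ - Λ(l))`.
    obtain ⟨x, hx⟩ := exists_subgradient isOpen_interior hfconv hpU
    have h1 := fenchel_subgradient_le hconv h0 hint hx
    have hval := le_fenchel_toReal hbot (interior_subset hpU) x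
    have h2 : inner ℝ (p • l) x - (Λ (p • l)).toReal ≤ κ' := by
      have h3 := (le_iSup₂ (f := fun x (_ : x ∈ effDomain (fenchel Λ)) => fenchel Λ x) x
        (h1.trans_lt (EReal.coe_lt_top _))).trans hcκ'.le
      exact_mod_cast hval.trans h3
    have h4 := hx l hl
    rw [show l - p • l = (1 - p) • l by rw [sub_smul, one_smul], real_inner_smul_right,
      real_inner_comm] at h4
    rw [real_inner_smul_left] at h2
    have hp0 : 0 < p := by linarith
    have h5 : inner ℝ l x ≤ (κ' + (Λ (p • l)).toReal) / p := by
      rw [le_div_iff₀ hp0]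
      linarith
    have h6 : (p - 1) * (inner ℝ l x - (Λ l).toReal) < (p - 1) * κ := by
      refine mul_lt_mul_of_pos_left ?_ (by linarith)
      linarith
    linarith
  · obtain ⟨p, hpU, hp1 : 1 < p⟩ := (hmem.and self_mem_nhdsWithin).exists
    refine ⟨p, ((Λ (p • l)).toReal - p * (Λ l).toReal) / (p - 1) + 1, hp1, hpU,
      hexp _ (htop.eventually_ge_atTop _), ?_⟩
    have : p - 1 ≠ 0 := by linarith
    rw [mul_add, mul_div_cancel₀ _ this]
    linarith

end Convergence

end LocalFluctuations

/-! ### Proof of the theorem. -/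

theorem corollary2p1
    {Ω E : Type*} [MeasurableSpace Ω] [MeasurableSpace E]
    (P : Measure Ω) [IsProbabilityMeasure P]
    -- the stationary process
    (X : ℕ → Ω → E) (hX : ∀ i, Measurable (X i)) (hstat : IsStationary P X)
    -- the functionals `S_n Φ`
    (d : ℕ) (hd : 1 ≤ d) (SΦ : ℕ → (ℕ → E) → EuclideanSpace ℝ (Fin d))
    (hSΦ : ∀ n, 1 ≤ n → Measurable (SΦ n))
    -- the number of blocks
    (k : ℕ → ℕ) (hkpos : ∀ n, 1 ≤ n → 0 < k n) (hkmono : MonotoneOn k (Set.Ici 1))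
    -- the limiting logarithmic generating function exists and is finite near the origin
    (Λ : EuclideanSpace ℝ (Fin d) → EReal)
    (hΛ : ∀ l, Tendsto (fun n : ℕ => logMGF (scaledLaw P X SΦ n) n l) atTop (𝓝 (Λ l)))
    (hΛ0 : (0 : EuclideanSpace ℝ (Fin d)) ∈ interior (effDomain Λ))
    -- mixing
    (hmix : ∀ h : ℝ, 0 < h → ∫⁻ u in Set.Icc (0 : ℝ) 1, (mixingInv P X u) ^ h < ⊤)
    -- approximation by functions of the first `2n` coordinates
    (happrox : ∃ g : ℕ → (ℕ → E) → EuclideanSpace ℝ (Fin d),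
      (∀ n, 1 ≤ n → DependsOnFirst (g n) (2 * n)) ∧
      Tendsto (fun n : ℕ => (⨆ z : ℕ → E, ‖SΦ n z - g n z‖ₑ) / (n : ℝ≥0∞)) atTop (𝓝 0))
    -- growth of the number of blocks
    (hk : ((⨆ x ∈ effDomain (fenchel Λ), fenchel Λ x) < ⊤ ∧
        (⨆ x ∈ effDomain (fenchel Λ), fenchel Λ x) <
          liminf (fun n : ℕ => ((Real.log (k n) / n : ℝ) : EReal)) atTop) ∨
      Tendsto (fun n : ℕ => Real.log (k n) / n) atTop atTop) :
    -- `Λ` does not take the value `-∞`, so that it is real-valued on its domain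
    (∀ l, Λ l ≠ ⊥) ∧
    ∀ᵐ ω ∂P,
      -- uniform convergence on the compact subsets of the interior of the domain
      (∀ K : Set (EuclideanSpace ℝ (Fin d)), IsCompact K → K ⊆ interior (effDomain Λ) →
        TendstoUniformlyOn
          (fun (n : ℕ) l => (logMGF (empiricalLaw SΦ k (fun i => X i ω) n) n l).toReal)
          (fun l => (Λ l).toReal) atTop K) ∧
      -- upper bound for closed sets
      (∀ F : Set (EuclideanSpace ℝ (Fin d)), IsClosed F →
        limsup (fun n : ℕ =>
          ENNReal.log (empiricalLaw SΦ k (fun i => X i ω) n F) / (n : EReal)) atTop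
          ≤ -(⨅ x ∈ F, fenchel Λ x)) ∧
      -- lower bound for open sets
      (∀ G : Set (EuclideanSpace ℝ (Fin d)), IsOpen G →
        -(⨅ x ∈ G ∩ exposedPoints Λ, fenchel Λ x) ≤
          liminf (fun n : ℕ =>
            ENNReal.log (empiricalLaw SΦ k (fun i => X i ω) n G) / (n : EReal)) atTop) ∧
      -- full large deviation principle
      (EssentiallySmooth Λ → LowerSemicontinuous Λ →
        IsGoodRateFunction (fenchel Λ) ∧
        SatisfiesLDP (fun n => empiricalLaw SΦ k (fun i => X i ω) n) (fenchel Λ)) := by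
  have hx : Measurable fun ω i => X i ω := measurable_pi_iff.2 hX
  have hconv : IsEConvex Λ := isEConvex_of_tendsto_logMGF hΛ
  have h0 : Λ 0 = 0 := by
    refine tendsto_nhds_unique (hΛ 0) (tendsto_const_nhds.congr' ?_)
    filter_upwards [eventually_ge_atTop 1] with n hn
    have : IsProbabilityMeasure (scaledLaw P X SΦ n) :=
      Measure.isProbabilityMeasure_map (((hSΦ n hn).comp hx).const_smul (n : ℝ)⁻¹).aemeasurable
    rw [logMGF_eq, expMoment_zero]
    simp
  have hbot := hconv.ne_bot h0 hΛ0
  refine ⟨hbot, ?_⟩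
  set U := interior (effDomain Λ) with hU
  have hreal : ∀ l ∈ U, ((Λ l).toReal : EReal) = Λ l := fun l hl =>
    coe_toReal_of_mem_effDomain (interior_subset hl) (hbot l)
  have hpt : ∀ l ∈ U, ∀ᵐ ω ∂P, Tendsto
      (fun n : ℕ => logMGF (empiricalLaw SΦ k (fun i => X i ω) n) n l) atTop (𝓝 (Λ l)) := by
    intro l hl
    obtain ⟨p, κ, hp, hpU, hκ, hgap⟩ := exists_moment_gap hconv h0 hΛ0 hkpos hk hl
    have hr := hΛ l
    have hs := hΛ (p • l)
    rw [← hreal l hl] at hr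
    rw [← hreal _ hpU] at hs
    -- The errors `1 / (m + 1)` suffice and keep the exceptional sets countable in number.
    have hup := fun m : ℕ => ae_eventually_expMoment_empiricalLaw_le hX hstat hSΦ hkpos hr
      (Nat.one_div_pos_of_nat (α := ℝ) (n := m))
    have hlow := fun m : ℕ => ae_eventually_le_expMoment_empiricalLaw hX hstat hSΦ hkpos hmix
      happrox hp hr hs hκ hgap (Nat.one_div_pos_of_nat (α := ℝ) (n := m))
    filter_upwards [ae_all_iff.2 hup, ae_all_iff.2 hlow] with ω h1 h2
    rw [← hreal l hl]
    refine tendsto_log_div_of_eventually (fun ε hε => ?_) fun ε hε => ?_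
    · obtain ⟨m, hm⟩ := exists_nat_one_div_lt hε
      refine (h1 m).mono fun n hn => hn.trans (ENNReal.ofReal_le_ofReal ?_)
      gcongr
    · obtain ⟨m, hm⟩ := exists_nat_one_div_lt hε
      refine (h2 m).mono fun n hn => (ENNReal.ofReal_le_ofReal ?_).trans hn
      gcongr
  -- One null set must serve all `l`, hence the restriction to a countable dense subset of `U`.
  set D := U ∩ Set.range (TopologicalSpace.denseSeq (EuclideanSpace ℝ (Fin d))) with hD
  have hDc : D.Countable := (Set.countable_range _).mono Set.inter_subset_right
  have hUD : U ⊆ closure D :=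
    (TopologicalSpace.denseRange_denseSeq _).open_subset_closure_inter isOpen_interior
  filter_upwards [(ae_ball_iff hDc).2 fun l hl => hpt l hl.1] with ω hω
  have hfconv : ConvexOn ℝ U fun l => (Λ l).toReal :=
    (hconv.convexOn_toReal hbot).subset interior_subset hconv.convex_effDomain.interior
  have hunif : ∀ K : Set (EuclideanSpace ℝ (Fin d)), IsCompact K → K ⊆ U → TendstoUniformlyOn
      (fun (n : ℕ) l => (logMGF (empiricalLaw SΦ k (fun i => X i ω) n) n l).toReal)
      (fun l => (Λ l).toReal) atTop K := by
    intro K hK hKU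
    refine tendstoUniformlyOn_of_tendsto_dense isOpen_interior Set.inter_subset_left hUD ?_
      (hfconv.continuousOn isOpen_interior) (fun l hl => ?_) hK hKU
    · filter_upwards [eventually_ge_atTop 1] with n hn
      exact (convexOn_logMGF_empiricalLaw _ hn (hkpos n hn)).subset (Set.subset_univ _)
        hconv.convex_effDomain.interior
    · exact (EReal.tendsto_toReal (ne_of_lt
        (show Λ l < ⊤ from (interior_subset hl.1 : l ∈ effDomain Λ))) (hbot l)).comp (hω l hl)
  -- Convergence at every point of `U`, for the same `ω`, is recovered from uniform convergence on
  -- singletons.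
  have hlim : ∀ l ∈ U, Tendsto
      (fun n : ℕ => logMGF (empiricalLaw SΦ k (fun i => X i ω) n) n l) atTop (𝓝 (Λ l)) := by
    intro l hl
    have h1 := (hunif {l} isCompact_singleton (Set.singleton_subset_iff.2 hl)).tendsto_at
      (Set.mem_singleton l)
    rw [← hreal l hl]
    refine ((continuous_coe_real_ereal.tendsto _).comp h1).congr' ?_
    filter_upwards [eventually_ge_atTop 1] with n hn
    exact coe_toReal_logMGF_empiricalLaw _ hn (hkpos n hn) l
  exact ⟨hunif, fun F hF => limsup_le_of_isClosed hconv h0 hΛ0 hlim hF,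
    fun G hG => le_liminf_of_isOpen hconv h0 hΛ0 hlim hG, fun hsm hlsc =>
    ⟨isGoodRateFunction_fenchel hbot h0 hΛ0, satisfiesLDP_of_tendsto hconv h0 hΛ0 hlim hsm hlsc⟩⟩
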